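/- A (planar) \emph{Tangle} is a smooth (i.e. continuously differentiable with continuously turning tangent) simple closed curve in the plane that is composed of finitely many \emph{links}, each of which is a quadrant (quarter) of a circle of one common radius $r>0$; the points where consecutive links meet are its \emph{joints}. A Tangle with $4c$ links is said to have \emph{class} $c$. A square packing by circles of radius $r$ is the family of circles of radius $r$ about the points $o+2ru(a+bi)\in\mathbb C$, $a,b\in\mathbb Z$, where $o,u\in\mathbb C$, $|u|=1$; it is colored like a chessboard with two colors, according to the parity of $a+b$. A Tangle fits in such a packing if all its links belong to circles of the packing and all its joints are points at which two circles of the packing touch. In that case, call \emph{black} the color of those circles that lie inside the Tangle and to which links of the Tangle belong. The vertices of the \emph{dual graph} of the Tangle are the centers of all the black circles inside the Tangle, and two vertices are connected by an edge if the line segment between them does not intersect the Tangle and intersects no circle of the packing other than the two circles about its end points. The \emph{size} of the Tangle is the number of edges of its dual graph. Theorem. Let $T$ be a Tangle of class $c$. Then $T$ fits in a square packing by circles of its radius, and with respect to every such packing its dual graph has finitely many edges and its size $m$ satisfies $$c-1\;\le\; m\;\le\;\frac{c^2-1}{2}.$$ -/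

import Mathlib

noncomputable section

/-- A (planar) Tangle: a smooth simple closed curve in the plane `ℂ`, composed of finitely many
links, each of which is a quadrant (quarter) of a circle of one common radius.

The curve is parametrized with constant speed, the `i`-th link being traversed while the parameter
runs through `[i, i + 1]`; so `curve i` is the joint at which the `i`-th link starts.  The `i`-th
link belongs to the circle about `center i`, starts at the polar angle `angle i` on that circle,
and is traversed counterclockwise or clockwise according as `turn i` is `1` or `-1`.
Since the speed is constant and nonzero, being continuously differentiable says that the curve has
a continuously turning tangent (no corners and no cusps), also where it closes up. -/
structure Tangle where
  /-- the common radius of the links -/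
  radius : ℝ
  radius_pos : 0 < radius
  /-- the number of links -/
  length : ℕ
  length_pos : 0 < length
  /-- the curve itself -/
  curve : ℝ → ℂ
  /-- the centers of the circles to which the links belong -/
  center : Fin length → ℂ
  /-- the polar angles at which the links start -/
  angle : Fin length → ℝ
  /-- the orientations of the links -/
  turn : Fin length → ℤˣ
  link : ∀ (i : Fin length) (t : ℝ), t ∈ Set.Icc (i : ℝ) ((i : ℝ) + 1) →
    curve t = center i + (radius : ℂ) *
      Complex.exp ((((angle i + (((turn i : ℤˣ) : ℤ) : ℝ) * ((t - (i : ℝ)) * (Real.pi / 2)) : ℝ)) : ℂ)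
        * Complex.I)
  closed : Function.Periodic curve (length : ℝ)
  simple : Set.InjOn curve (Set.Ico (0 : ℝ) (length : ℝ))
  smooth : ContDiff ℝ 1 curve

namespace Tangle

/-- A Tangle has class `c` if it has `4 * c` links. -/
def HasClass (T : Tangle) (c : ℕ) : Prop :=
  T.length = 4 * c

/-- The set of points lying on the Tangle. -/
def carrier (T : Tangle) : Set ℂ :=
  Set.range T.curve

/-- The region enclosed by the Tangle: the points off the curve whose connected component in the
complement of the curve is bounded. -/
def inside (T : Tangle) : Set ℂ :=
  {p | p ∉ T.carrier ∧ Bornology.IsBounded (connectedComponentIn T.carrierᶜ p)}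

end Tangle

/-- A square packing of the plane by circles of radius `r`, given by the center `origin` of one of
its circles and a unit vector `dir` pointing from there to the center of a kissing circle. -/
structure SquarePacking (r : ℝ) where
  origin : ℂ
  dir : ℂ
  norm_dir : ‖dir‖ = 1

namespace SquarePacking

variable {r : ℝ}

/-- The centers of the circles of the packing, indexed by `ℤ × ℤ`. -/
def center (P : SquarePacking r) (z : ℤ × ℤ) : ℂ :=
  P.origin + 2 * (r : ℂ) * P.dir * ((z.1 : ℂ) + (z.2 : ℂ) * Complex.I)

end SquarePacking

/-- The chessboard coloring of the circles of a square packing: `z` and `w` have the same color. -/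
def SameColor (z w : ℤ × ℤ) : Prop :=
  Even (z.1 + z.2) ↔ Even (w.1 + w.2)

namespace Tangle

/-- The links of the Tangle belong to circles of the packing, and its joints are among the
four points at which such a circle kisses the neighboring circles. -/
def FitsIn (T : Tangle) (P : SquarePacking T.radius) : Prop :=
  ∀ i : Fin T.length,
    (∃ z : ℤ × ℤ, T.center i = P.center z) ∧
      ∃ k : ℕ, T.curve (i : ℝ) = T.center i + (T.radius : ℂ) * P.dir * Complex.I ^ k

variable (T : Tangle) (P : SquarePacking T.radius)

/-- The circle with index `z` lies inside the Tangle (links of the Tangle may run along it). -/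
def CircleInside (z : ℤ × ℤ) : Prop :=
  Metric.ball (P.center z) T.radius ⊆ T.inside

/-- The black circles: those which have the color of the circles that lie inside the Tangle and
to which links of the Tangle belong. -/
def IsBlack (z : ℤ × ℤ) : Prop :=
  ∃ (i : Fin T.length) (w : ℤ × ℤ),
    P.center w = T.center i ∧ T.CircleInside P w ∧ SameColor z w

/-- The vertices of the dual graph: (the centers of) the black circles inside the Tangle. -/
def dualVertices : Set (ℤ × ℤ) :=
  {z | T.IsBlack P z ∧ T.CircleInside P z}

/-- The dual graph: two vertices are connected if the line segment between them does not intersect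
the Tangle, nor any circle of the packing other than the two about its end points. -/
def dualGraph : SimpleGraph (T.dualVertices P) where
  Adj z w := z ≠ w ∧
    Disjoint (segment ℝ (P.center z) (P.center w)) T.carrier ∧
    ∀ q : ℤ × ℤ, q ≠ z → q ≠ w →
      Disjoint (segment ℝ (P.center z) (P.center w)) (Metric.closedBall (P.center q) T.radius)
  symm := ⟨by
    rintro z w ⟨h, h1, h2⟩
    rw [segment_symm] at h1
    refine ⟨h.symm, h1, fun q hq hq' => ?_⟩
    rw [segment_symm]
    exact h2 q hq' hq⟩
  loopless := ⟨fun _ h => h.1 rfl⟩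

/-- The size of the Tangle: the number of edges of its dual graph. -/
def size : ℕ :=
  (T.dualGraph P).edgeSet.ncard

end Tangle

end

/-! The Tangle is read off on the integer lattice of circle centers (`LatticeTrace`), each link
being a quadrant `(ctr n, fst n + snd n)`. Instead of the Jordan curve theorem, winding numbers and
boundedness tell inside from outside. The winding number jumps across a joint and vanishes outside,
so the two circles kissing at a joint are not both outside (`center_mem_inside_or`). The inside
status of each color is constant along the curve; were both sides inside, the circles inside would
be closed under a translation, contradicting boundedness. Hence one color, black, is inside at every
joint and the other, white, is outside (`exists_forall_isSide`).

Let V and W be the sets of black and of white circles inside, and m the number of edges, all of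
which are diagonal. A quadrant of a circle in V carries a link or faces an edge: 4|V| = (black
links) + 2m. Each edge runs between two white quadrants, and the white quadrants that arise are the
white links and the quadrants of W: 2m = (white links) + 4|W|. Together, |V| = c + |W|
(`card_insideCircles`).

Lower bound: the dual graph is connected (`connected_dualGraph`), so c ≤ |V| ≤ m + 1.

Upper bound: let the edges of the two diagonal directions number e₁ and e₂, let V meet p and q
diagonal lines of the two directions, and let the edges occupy q' and p' levels along their
directions. Counting along lines and across levels gives p + q' ≤ c, q + p' ≤ c, e₁ ≤ pq', e₂ ≤ qp',
with q' < q and p' < p (`card_add_card_image_le`). The inequality between arithmetic and geometric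
mean, which cannot be sharp in both directions, yields 2m + 1 ≤ c² (`two_mul_add_one_le_sq_of_le`).
-/

noncomputable section

/-! ### Winding numbers of closed C¹ curves. -/

open MeasureTheory Set Filter Topology

/-- The integral whose quotient by `2πi` is the winding number about `p` of the closed curve `γ`
of period `L`. -/
def windingIntegral (γ : ℝ → ℂ) (L : ℝ) (p : ℂ) : ℂ :=
  ∫ t in (0 : ℝ)..L, deriv γ t / (γ t - p)

section Winding

variable {γ : ℝ → ℂ} {L : ℝ} {p q : ℂ}

lemma continuous_logDeriv_sub (hγ : ContDiff ℝ 1 γ) (hp : p ∉ range γ) :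
    Continuous fun t => deriv γ t / (γ t - p) := by
  refine (hγ.continuous_deriv le_rfl).div (hγ.continuous.sub continuous_const) fun t => ?_
  exact sub_ne_zero.2 fun h => hp ⟨t, h⟩

/-- The integral is a logarithm of `γ - p` along the curve: the product of `γ - p` with the
exponential of minus the integral has derivative zero. -/
lemma sub_eq_mul_exp_integral (hγ : ContDiff ℝ 1 γ) (hp : p ∉ range γ) (a x : ℝ) :
    γ x - p = (γ a - p) * Complex.exp (∫ t in a..x, deriv γ t / (γ t - p)) := by
  have hc := continuous_logDeriv_sub hγ hp
  have hne : ∀ t, γ t - p ≠ 0 := fun t => sub_ne_zero.2 fun h => hp ⟨t, h⟩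
  have hd : ∀ x, HasDerivAt (fun x => (γ x - p) * Complex.exp (-∫ t in a..x, deriv γ t / (γ t - p)))
      0 x := by
    intro x
    have h1 : HasDerivAt (fun x => ∫ t in a..x, deriv γ t / (γ t - p)) _ x :=
      intervalIntegral.integral_hasDerivAt_right (hc.intervalIntegrable _ _)
        (hc.stronglyMeasurableAtFilter _ _) hc.continuousAt
    have h2 : HasDerivAt γ (deriv γ x) x := (hγ.differentiable one_ne_zero x).hasDerivAt
    refine ((h2.sub_const p).mul h1.neg.cexp).congr_deriv ?_
    have := div_mul_cancel₀ (deriv γ x) (hne x)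
    linear_combination (-Complex.exp (-∫ t in a..x, deriv γ t / (γ t - p))) * this
  have h0 := is_const_of_deriv_eq_zero (fun x => (hd x).differentiableAt) (fun x => (hd x).deriv) x a
  simp only [intervalIntegral.integral_same, neg_zero, Complex.exp_zero, mul_one] at h0
  rw [← h0, mul_assoc, ← Complex.exp_add]
  simp

lemma exists_windingIntegral_eq (hγ : ContDiff ℝ 1 γ) (hL : Function.Periodic γ L)
    (hp : p ∉ range γ) : ∃ n : ℤ, windingIntegral γ L p = n * (2 * Real.pi * Complex.I) := by
  rw [← Complex.exp_eq_one_iff]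
  have h := sub_eq_mul_exp_integral hγ hp 0 L
  have hne : γ 0 - p ≠ 0 := sub_ne_zero.2 fun h => hp ⟨0, h⟩
  have h2 : γ L = γ 0 := by simpa using hL 0
  rw [h2] at h
  exact (mul_eq_left₀ hne).1 h.symm

lemma continuousOn_windingIntegral (hγ : ContDiff ℝ 1 γ) :
    ContinuousOn (windingIntegral γ L) (range γ)ᶜ := by
  rw [continuousOn_iff_continuous_domRestrict]
  refine intervalIntegral.continuous_parametric_intervalIntegral_of_continuous'
    (f := fun (p : ((range γ)ᶜ : Set ℂ)) t => deriv γ t / (γ t - p)) ?_ 0 L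
  have h1 := hγ.continuous_deriv le_rfl
  have h2 := hγ.continuous
  refine Continuous.div (by fun_prop) (by fun_prop) ?_
  rintro ⟨p, t⟩
  exact sub_ne_zero.2 fun h => p.2 ⟨t, h⟩

lemma windingIntegral_eq_of_isPreconnected (hγ : ContDiff ℝ 1 γ) (hL : Function.Periodic γ L)
    {s : Set ℂ} (hs : IsPreconnected s) (hsγ : s ⊆ (range γ)ᶜ) (hp : p ∈ s) (hq : q ∈ s) :
    windingIntegral γ L p = windingIntegral γ L q := by
  choose! n hn using fun (p : ℂ) (hp : p ∈ s) => exists_windingIntegral_eq hγ hL (hsγ hp)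
  have hpi : (2 * Real.pi * Complex.I : ℂ) ≠ 0 := Complex.two_pi_I_ne_zero
  have hc : ContinuousOn n s := by
    rw [Int.isClosedEmbedding_coe_real.isEmbedding.continuousOn_iff]
    have h1 : ContinuousOn (fun p => (windingIntegral γ L p / (2 * Real.pi * Complex.I)).re) s :=
      Complex.continuous_re.comp_continuousOn
        (((continuousOn_windingIntegral hγ).mono hsγ).div_const _)
    refine h1.congr fun p hp => ?_
    simp only [Function.comp, hn p hp, mul_div_assoc, div_self hpi]
    simp
  rw [hn p hp, hn q hq, hs.constant hc hp hq]

lemma windingIntegral_eq_zero_of_not_isBounded (hγ : ContDiff ℝ 1 γ) (hL : Function.Periodic γ L)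
    (hL0 : 0 < L) (hp : p ∉ range γ)
    (hb : ¬ Bornology.IsBounded (connectedComponentIn (range γ)ᶜ p)) :
    windingIntegral γ L p = 0 := by
  obtain ⟨R, hR⟩ := (isCompact_Icc (a := 0) (b := L)).exists_bound_of_continuousOn
    hγ.continuous.continuousOn
  obtain ⟨C, hC⟩ := (isCompact_Icc (a := 0) (b := L)).exists_bound_of_continuousOn
    (hγ.continuous_deriv le_rfl).continuousOn
  have hC0 : 0 ≤ C := (norm_nonneg _).trans (hC 0 ⟨le_rfl, hL0.le⟩)
  -- A point this far out has distance at least `C * L + 1` from the curve, so its integral has norm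
  -- at most `C * L / (C * L + 1) < 1`, too small for a nonzero multiple of `2πi`.
  have hsub : ¬ connectedComponentIn (range γ)ᶜ p ⊆ Metric.closedBall 0 (R + C * L + 1) :=
    fun h => hb (Metric.isBounded_closedBall.subset h)
  obtain ⟨q, hq, hqR⟩ := not_subset.1 hsub
  have hpmem : p ∈ connectedComponentIn (range γ)ᶜ p := mem_connectedComponentIn hp
  rw [windingIntegral_eq_of_isPreconnected hγ hL isPreconnected_connectedComponentIn
    (connectedComponentIn_subset _ _) hpmem hq]
  obtain ⟨n, hn⟩ := exists_windingIntegral_eq hγ hL (connectedComponentIn_subset _ _ hq)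
  have hqR' : R + C * L + 1 < ‖q‖ := by simpa using hqR
  have hbd : ‖windingIntegral γ L q‖ ≤ C / (C * L + 1) * |L - 0| := by
    refine intervalIntegral.norm_integral_le_of_norm_le_const fun t ht => ?_
    rw [uIoc_of_le hL0.le] at ht
    have ht' : t ∈ Icc 0 L := ⟨ht.1.le, ht.2⟩
    rw [norm_div]
    have h1 : C * L + 1 ≤ ‖γ t - q‖ := by
      have := norm_sub_norm_le q (γ t)
      rw [norm_sub_rev] at this
      linarith [hR t ht']
    exact div_le_div₀ hC0 (hC t ht') (by positivity) h1
  have hlt : ‖windingIntegral γ L q‖ < 1 := by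
    refine hbd.trans_lt ?_
    rw [sub_zero, abs_of_pos hL0, div_mul_eq_mul_div, div_lt_one (by positivity)]
    linarith
  rw [hn] at hlt ⊢
  have h3 : (1 : ℝ) < 2 * Real.pi := by linarith [Real.pi_gt_three]
  have h4 : ‖(n : ℂ) * (2 * Real.pi * Complex.I)‖ = |(n : ℝ)| * (2 * Real.pi) := by
    simp [abs_of_pos Real.pi_pos]
  rw [h4] at hlt
  have h5 : |(n : ℝ)| < 1 := by nlinarith [abs_nonneg (n : ℝ)]
  have h6 : n = 0 := by
    rw [← Int.abs_lt_one_iff]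
    exact_mod_cast h5
  simp [h6]

lemma exists_gt_im_pos {f : ℝ → ℂ} {a b : ℝ} (hab : a < b) {d : ℂ} (h : HasDerivAt f d a)
    (h0 : (f a).im = 0) (hd : 0 < d.im) : ∃ t ∈ Ioo a b, 0 < (f t).im := by
  have h1 : HasDerivAt (fun t => (f t).im) d.im a :=
    (Complex.imCLM.hasFDerivAt.comp_hasDerivAt a h)
  have h2 := (hasDerivAt_iff_tendsto_slope.1 h1).mono_left
    (show 𝓝[>] a ≤ 𝓝[≠] a from nhdsWithin_mono a (fun x hx => ne_of_gt hx))
  have h3 := (h2.eventually (lt_mem_nhds hd)).and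
    (show ∀ᶠ t in 𝓝[>] a, t ∈ Ioo a b from Ioo_mem_nhdsGT hab)
  obtain ⟨t, ht, htab⟩ := h3.exists
  refine ⟨t, htab, ?_⟩
  rw [slope_def_field, h0, sub_zero] at ht
  have : 0 < t - a := sub_pos.2 htab.1
  have h5 := mul_pos ht this
  rwa [div_mul_cancel₀ _ this.ne'] at h5

/-- The imaginary part is positive just after `a` and negative just before `b`, so it vanishes in
between. -/
lemma exists_mem_Ioo_im_eq_zero {ℓ : ℝ → ℂ} {a b : ℝ} (hab : a < b) {d : ℂ} (hc : Continuous ℓ)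
    (ha : HasDerivAt ℓ d a) (hb : HasDerivAt ℓ d b) (ha0 : (ℓ a).im = 0) (hb0 : (ℓ b).im = 0)
    (hd : 0 < d.im) : ∃ t ∈ Ioo a b, (ℓ t).im = 0 := by
  obtain ⟨t, ht, htp⟩ := exists_gt_im_pos hab ha ha0 hd
  -- The point reflection `s ↦ -ℓ (-s)` keeps the derivative and turns the left side of `b` into the
  -- right side of `-b`.
  have hb' : HasDerivAt (fun s => -ℓ (-s)) d (-b) := by
    have h1 : HasDerivAt ℓ d (- -b) := by rwa [neg_neg]
    refine (h1.scomp (-b) (hasDerivAt_neg (-b))).neg.congr_deriv ?_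
    simp
  obtain ⟨s, hs, hsp⟩ := exists_gt_im_pos (neg_lt_neg hab) hb' (by simpa using hb0) hd
  have hs' : -s ∈ Ioo a b := ⟨by linarith [hs.2], by linarith [hs.1]⟩
  have hci : Continuous fun t => (ℓ t).im := Complex.continuous_im.comp hc
  have := isPreconnected_Ioo.intermediate_value hs' ht hci.continuousOn
  exact this ⟨by simpa using hsp.le, htp.le⟩

/-- A closed curve that passes through the segment `[p, q]` only once, at a point dividing it
with ratio `ρ` and not tangentially, winds differently about `p` and `q`. -/
lemma windingIntegral_ne (hγ : ContDiff ℝ 1 γ) (hL : Function.Periodic γ L) (hL0 : 0 < L)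
    (hp : p ∉ range γ) (hq : q ∉ range γ) (t₀ : ℝ) {ρ : ℝ}
    (hcross : γ t₀ - p = -(ρ * (γ t₀ - q)))
    (hint : ∀ t ∈ Ioo t₀ (t₀ + L), ∀ y : ℝ, 0 < y → γ t - p ≠ -(y * (γ t - q)))
    (hρ : 0 < ρ)
    (htr : (deriv γ t₀ / (γ t₀ - p) - deriv γ t₀ / (γ t₀ - q)).im ≠ 0) :
    windingIntegral γ L p ≠ windingIntegral γ L q := by
  intro heq
  have hcp := continuous_logDeriv_sub hγ hp
  have hcq := continuous_logDeriv_sub hγ hq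
  -- `ℓ` is a logarithm of `(γ - p) / (γ - q)`, normalized to be zero at `t₀`. The curve meets the
  -- open segment exactly where this quotient is a negative real, in particular wherever `ℓ` is
  -- real. Equal windings would make `ℓ` vanish again at `t₀ + L` with the same slope, forcing a
  -- real value in between.
  set ℓ : ℝ → ℂ := fun x => (∫ t in t₀..x, deriv γ t / (γ t - p)) -
    ∫ t in t₀..x, deriv γ t / (γ t - q) with hℓ
  have hder : ∀ x, HasDerivAt ℓ (deriv γ x / (γ x - p) - deriv γ x / (γ x - q)) x := fun x =>
    (intervalIntegral.integral_hasDerivAt_right (hcp.intervalIntegrable _ _)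
        (hcp.stronglyMeasurableAtFilter _ _) hcp.continuousAt).sub
    (intervalIntegral.integral_hasDerivAt_right (hcq.intervalIntegrable _ _)
        (hcq.stronglyMeasurableAtFilter _ _) hcq.continuousAt)
  have hcont : Continuous ℓ := continuous_iff_continuousAt.2 fun x => (hder x).continuousAt
  have hdper : Function.Periodic (deriv γ) L := fun x => by
    rw [← deriv_comp_add_const γ L x]
    congr 1
    exact funext hL
  have hper : ∀ r, Function.Periodic (fun t => deriv γ t / (γ t - r)) L := fun r t => by
    simp only [hdper t, hL t]
  have hb0 : ℓ (t₀ + L) = 0 := by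
    simp only [hℓ]
    rw [(hper p).intervalIntegral_add_eq t₀ 0, (hper q).intervalIntegral_add_eq t₀ 0, zero_add,
      sub_eq_zero]
    exact heq
  have ha0 : ℓ t₀ = 0 := by simp [hℓ]
  have hdb := hder (t₀ + L)
  rw [hdper, hL] at hdb
  have hex : ∃ t ∈ Ioo t₀ (t₀ + L), (ℓ t).im = 0 := by
    rcases lt_or_gt_of_ne htr with h | h
    · obtain ⟨t, ht, h1⟩ := exists_mem_Ioo_im_eq_zero (ℓ := fun t => -ℓ t) (by linarith : t₀ < t₀ + L)
        hcont.neg (hder t₀).neg hdb.neg (by simp [ha0]) (by simp [hb0])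
        (by rw [Complex.neg_im]; linarith)
      exact ⟨t, ht, by simpa using h1⟩
    · exact exists_mem_Ioo_im_eq_zero (by linarith) hcont (hder t₀) hdb (by simp [ha0]) (by simp [hb0]) h
  obtain ⟨t, ht, him⟩ := hex
  have h1 := sub_eq_mul_exp_integral hγ hp t₀ t
  have h2 := sub_eq_mul_exp_integral hγ hq t₀ t
  have hre : ℓ t = ((ℓ t).re : ℂ) := Complex.ext rfl (by simpa using him)
  refine hint t ht (ρ * Real.exp (ℓ t).re) (by positivity) ?_
  have h3 : Complex.exp (∫ s in t₀..t, deriv γ s / (γ s - p)) =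
      Complex.exp (∫ s in t₀..t, deriv γ s / (γ s - q)) * Complex.exp ((ℓ t).re : ℂ) := by
    rw [← hre, ← Complex.exp_add]
    congr 1
    simp only [hℓ]
    ring
  rw [h1, h2, h3, hcross]
  push_cast
  ring

end Winding

end

/-! ### From the Tangle to the lattice of circle centers. -/

noncomputable section

open Set

/-- The Gaussian integer with the given coordinates, as a complex number. -/
def latticePoint (z : ℤ × ℤ) : ℂ := (z.1 : ℂ) + (z.2 : ℂ) * Complex.I

lemma latticePoint_re (z : ℤ × ℤ) : (latticePoint z).re = z.1 := by simp [latticePoint]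

lemma latticePoint_im (z : ℤ × ℤ) : (latticePoint z).im = z.2 := by simp [latticePoint]

lemma latticePoint_add (z w : ℤ × ℤ) : latticePoint (z + w) = latticePoint z + latticePoint w := by
  simp [latticePoint]; ring

lemma latticePoint_neg (z : ℤ × ℤ) : latticePoint (-z) = -latticePoint z := by
  simp [latticePoint]; ring

lemma latticePoint_sub (z w : ℤ × ℤ) : latticePoint (z - w) = latticePoint z - latticePoint w := by
  simp [latticePoint]; ring

lemma latticePoint_injective : Function.Injective latticePoint := fun z w h => by
  have h1 := congrArg Complex.re h
  have h2 := congrArg Complex.im h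
  simp only [latticePoint_re, latticePoint_im, Int.cast_inj] at h1 h2
  exact Prod.ext h1 h2

/-- Unit vectors along the axes of the square lattice. -/
def IsAxis (e : ℤ × ℤ) : Prop := e = (1, 0) ∨ e = (0, 1) ∨ e = (-1, 0) ∨ e = (0, -1)

/-- Rotation of the square lattice by a right angle. -/
def rotate (e : ℤ × ℤ) : ℤ × ℤ := (-e.2, e.1)

lemma latticePoint_rotate (e : ℤ × ℤ) :
    latticePoint (rotate e) = Complex.I * latticePoint e := by
  simp only [latticePoint, rotate]
  push_cast
  linear_combination (-(e.2 : ℂ)) * Complex.I_mul_I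

lemma IsAxis.rotate {e : ℤ × ℤ} (h : IsAxis e) : IsAxis (rotate e) := by
  rcases h with rfl | rfl | rfl | rfl <;> simp [IsAxis, _root_.rotate]

lemma IsAxis.neg {e : ℤ × ℤ} (h : IsAxis e) : IsAxis (-e) := by
  rcases h with rfl | rfl | rfl | rfl <;> simp [IsAxis]

lemma exists_isAxis_latticePoint_eq (k : ℕ) : ∃ e, IsAxis e ∧ latticePoint e = Complex.I ^ k := by
  induction k with
  | zero => exact ⟨(1, 0), by simp [IsAxis], by simp [latticePoint]⟩
  | succ k ih =>
    obtain ⟨e, he, h⟩ := ih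
    exact ⟨_, he.rotate, by rw [latticePoint_rotate, h, pow_succ']⟩

lemma SquarePacking.center_eq {r : ℝ} (P : SquarePacking r) (z : ℤ × ℤ) :
    P.center z = P.origin + 2 * (r : ℂ) * P.dir * latticePoint z := rfl

lemma SquarePacking.dir_ne_zero {r : ℝ} (P : SquarePacking r) : P.dir ≠ 0 := by
  rw [← norm_ne_zero_iff, P.norm_dir]
  exact one_ne_zero

namespace Tangle

variable (T : Tangle)

/-- The index of the `n`-th link, counted periodically. -/
def idx (n : ℤ) : Fin T.length :=
  ⟨(n % T.length).toNat, by
    have h : (0 : ℤ) < T.length := by exact_mod_cast T.length_pos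
    have := Int.emod_lt_of_pos n h
    have := Int.emod_nonneg n h.ne'
    omega⟩

lemma idx_val (n : ℤ) : ((T.idx n : ℕ) : ℤ) = n % T.length := by
  have h : (0 : ℤ) < T.length := by exact_mod_cast T.length_pos
  have := Int.emod_nonneg n h.ne'
  simp only [idx]
  omega

lemma idx_congr {n m : ℤ} (h : n ≡ m [ZMOD T.length]) : T.idx n = T.idx m := by
  ext
  have : ((T.idx n : ℕ) : ℤ) = (T.idx m : ℕ) := by rw [idx_val, idx_val]; exact h
  exact_mod_cast this

lemma idx_coe (i : Fin T.length) : T.idx (i : ℕ) = i := by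
  ext
  have h := T.idx_val (i : ℕ)
  rw [Int.emod_eq_of_lt (by positivity) (by exact_mod_cast i.2)] at h
  exact_mod_cast h

/-- The direction from the center of the `n`-th link to its start. -/
def startDir (n : ℤ) : ℂ := Complex.exp ((T.angle (T.idx n) : ℂ) * Complex.I)

/-- The orientation of the `n`-th link, as a complex number. -/
def orient (n : ℤ) : ℂ := (((T.turn (T.idx n) : ℤˣ) : ℤ) : ℂ)

lemma orient_mul_self (n : ℤ) : T.orient n * T.orient n = 1 := by
  rcases Int.units_eq_one_or (T.turn (T.idx n)) with h | h <;> simp [orient, h]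

lemma radius_ne_zero : (T.radius : ℂ) ≠ 0 := by exact_mod_cast T.radius_pos.ne'

lemma curve_add_int_mul (t : ℝ) (k : ℤ) : T.curve (t + k * T.length) = T.curve t :=
  T.closed.int_mul k t

lemma curve_eq_of_mem_Icc (n : ℤ) {t : ℝ} (ht : t ∈ Icc (n : ℝ) (n + 1)) :
    T.curve t = T.center (T.idx n) + T.radius * T.startDir n *
      (Complex.cos ((t - n) * (Real.pi / 2)) +
        T.orient n * Complex.I * Complex.sin ((t - n) * (Real.pi / 2))) := by
  have hn : (n : ℝ) = (T.idx n : ℕ) + (n / T.length : ℤ) * (T.length : ℝ) := by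
    have h1 := Int.emod_add_mul_ediv n T.length
    rw [← T.idx_val n] at h1
    have h2 : ((n : ℤ) : ℝ) = ((((T.idx n : ℕ) : ℤ) + T.length * (n / T.length) : ℤ) : ℝ) := by
      rw [h1]
    rw [h2]
    push_cast
    ring
  set s : ℝ := t - (n / T.length : ℤ) * (T.length : ℝ) with hs
  have hts : t = s + (n / T.length : ℤ) * (T.length : ℝ) := by rw [hs]; ring
  have hsI : s ∈ Icc ((T.idx n : ℕ) : ℝ) ((T.idx n : ℕ) + 1) :=
    ⟨by linarith [ht.1], by linarith [ht.2]⟩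
  have htn : t - n = s - (T.idx n : ℕ) := by linarith
  rw [hts, curve_add_int_mul, T.link _ _ hsI, ← hts]
  have htn' : ((t : ℂ) - n) = ((t - n : ℝ) : ℂ) := by push_cast; rfl
  rw [htn', htn]
  simp only [startDir, orient]
  rw [mul_assoc, Complex.ofReal_add, add_mul, Complex.exp_add]
  congr 3
  rcases Int.units_eq_one_or (T.turn (T.idx n)) with h | h <;>
  · rw [h, Complex.exp_mul_I]
    push_cast
    simp only [one_mul, neg_mul, Complex.cos_neg, Complex.sin_neg]
    ring

lemma curve_intCast (n : ℤ) :
    T.curve n = T.center (T.idx n) + T.radius * T.startDir n := by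
  rw [T.curve_eq_of_mem_Icc n ⟨le_rfl, by linarith⟩]
  simp

lemma curve_intCast_add_one (n : ℤ) :
    T.curve (n + 1) = T.center (T.idx n) + T.radius * T.startDir n * (T.orient n * Complex.I) := by
  rw [T.curve_eq_of_mem_Icc n ⟨by linarith, le_rfl⟩]
  simp

lemma deriv_curve_of_mem_Icc (n : ℤ) {t : ℝ} (ht : t ∈ Icc (n : ℝ) (n + 1)) :
    deriv T.curve t = T.radius * T.startDir n * (Real.pi / 2) *
      (-Complex.sin ((t - n) * (Real.pi / 2)) +
        T.orient n * Complex.I * Complex.cos ((t - n) * (Real.pi / 2))) := by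
  have h1 : HasDerivWithinAt T.curve (deriv T.curve t) (Icc (n : ℝ) (n + 1)) t :=
    (T.smooth.differentiable one_ne_zero t).hasDerivAt.hasDerivWithinAt
  have hlin : HasDerivAt (fun s : ℝ => ((s : ℂ) - n) * (Real.pi / 2)) (Real.pi / 2 : ℂ) t := by
    simpa using (((hasDerivAt_id t).ofReal_comp.sub_const (n : ℂ)).mul_const ((Real.pi : ℂ) / 2))
  have hcos := (Complex.hasDerivAt_cos (((t : ℂ) - n) * (Real.pi / 2))).comp t hlin
  have hsin := (Complex.hasDerivAt_sin (((t : ℂ) - n) * (Real.pi / 2))).comp t hlin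
  have h2 := (((hcos.add (hsin.const_mul (T.orient n * Complex.I))).const_mul
    (T.radius * T.startDir n)).const_add (T.center (T.idx n))).hasDerivWithinAt
      (s := Icc (n : ℝ) (n + 1))
  have h3 := h2.congr (fun s hs => T.curve_eq_of_mem_Icc n hs) (T.curve_eq_of_mem_Icc n ht)
  have hu := uniqueDiffOn_Icc (by linarith : (n : ℝ) < n + 1) t ht
  rw [(h1.derivWithin hu).symm.trans (h3.derivWithin hu)]
  ring

/-- The one-sided tangents of two consecutive links agree at their common joint. -/
lemma orient_mul_startDir_succ (n : ℤ) :
    T.orient (n + 1) * Complex.I * T.startDir (n + 1) = -T.startDir n := by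
  have h1 := T.deriv_curve_of_mem_Icc n (t := n + 1) ⟨by linarith, le_rfl⟩
  have h2 := T.deriv_curve_of_mem_Icc (n + 1) (t := n + 1)
    ⟨by push_cast; exact le_rfl, by push_cast; linarith⟩
  rw [h1] at h2
  push_cast at h2
  simp only [add_sub_cancel_left, sub_self, zero_mul, one_mul, Complex.sin_pi_div_two,
    Complex.cos_pi_div_two, Complex.sin_zero, Complex.cos_zero] at h2
  have h3 : (T.radius : ℂ) * (Real.pi / 2) ≠ 0 :=
    mul_ne_zero T.radius_ne_zero (by exact_mod_cast (by positivity : Real.pi / 2 ≠ 0))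
  apply mul_left_cancel₀ h3
  linear_combination -h2

lemma startDir_succ (n : ℤ) :
    T.startDir (n + 1) = T.orient (n + 1) * Complex.I * T.startDir n := by
  have h1 := T.orient_mul_startDir_succ n
  have h2 := T.orient_mul_self (n + 1)
  linear_combination (-T.startDir (n + 1)) * h2 - T.orient (n + 1) * Complex.I * h1 +
    (T.orient (n + 1) * T.orient (n + 1) * T.startDir (n + 1)) * Complex.I_mul_I

lemma center_idx_succ (n : ℤ) : T.center (T.idx (n + 1)) = T.center (T.idx n) +
    T.radius * ((T.orient n - T.orient (n + 1)) * Complex.I * T.startDir n) := by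
  have h1 := T.curve_intCast_add_one n
  have h2 := T.curve_intCast (n + 1)
  push_cast at h2
  rw [h2, T.startDir_succ n] at h1
  linear_combination h1

lemma orient_eq (n : ℤ) : T.orient n = 1 ∨ T.orient n = -1 := by
  rcases Int.units_eq_one_or (T.turn (T.idx n)) with h | h <;> simp [orient, h]

/-- Every Tangle fits in a square packing. -/
lemma exists_fitsIn : ∃ P : SquarePacking T.radius, T.FitsIn P := by
  -- The first link determines the packing; induction along the curve shows that the others fit.
  let P : SquarePacking T.radius := ⟨T.center (T.idx 0), T.startDir 0, by
    simp [startDir, Complex.norm_exp_ofReal_mul_I]⟩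
  have key : ∀ n : ℕ, (∃ k : ℕ, T.startDir n = P.dir * Complex.I ^ k) ∧
      ∃ z, T.center (T.idx n) = P.center z := by
    intro n
    induction n with
    | zero =>
      exact ⟨⟨0, by simp [P]⟩, (0, 0), by simp [SquarePacking.center, P]⟩
    | succ n ih =>
      obtain ⟨⟨k, hk⟩, z, hz⟩ := ih
      push_cast
      rw [T.startDir_succ, T.center_idx_succ, hk, hz]
      obtain ⟨e, -, he⟩ := exists_isAxis_latticePoint_eq (k + 1)
      have hI : (Complex.I * Complex.I ^ k) = Complex.I ^ (k + 1) := by rw [pow_succ']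
      have hI3 : -(Complex.I * Complex.I ^ k) = Complex.I ^ (k + 3) := by
        rw [pow_add, Complex.I_pow_three]; ring
      constructor
      · rcases T.orient_eq (n + 1) with h | h
        · exact ⟨k + 1, by rw [h, ← hI]; ring⟩
        · exact ⟨k + 3, by rw [h, ← hI3]; ring⟩
      -- The center stays put where the orientation persists and moves to a kissing circle where it
      -- changes.
      · rcases T.orient_eq n with h | h <;> rcases T.orient_eq (n + 1) with h' | h' <;> rw [h, h']
        · exact ⟨z, by ring⟩
        · refine ⟨z + e, ?_⟩
          rw [P.center_eq, P.center_eq, latticePoint_add, he, ← hI]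
          ring
        · refine ⟨z - e, ?_⟩
          rw [P.center_eq, P.center_eq, latticePoint_sub, he, ← hI]
          ring
        · exact ⟨z, by ring⟩
  refine ⟨P, fun i => ?_⟩
  obtain ⟨⟨k, hk⟩, z, hz⟩ := key i
  have hc := T.curve_intCast (i : ℕ)
  push_cast at hc hk hz
  rw [hk, T.idx_coe] at hc
  rw [T.idx_coe] at hz
  exact ⟨⟨z, hz⟩, k, by rw [hc]; ring⟩

lemma exists_int_of_curve_eq {s t : ℝ} (h : T.curve s = T.curve t) :
    ∃ k : ℤ, s - t = k * T.length := by
  have hL : (0 : ℝ) < T.length := by exact_mod_cast T.length_pos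
  have key : ∀ s : ℝ, ∃ k : ℤ, s + k * T.length ∈ Ico (0 : ℝ) T.length := fun s => by
    obtain ⟨k, hk, -⟩ := existsUnique_add_zsmul_mem_Ico hL s 0
    exact ⟨k, by simpa using hk⟩
  obtain ⟨k, hk⟩ := key s
  obtain ⟨l, hl⟩ := key t
  have := T.simple hk hl (by rw [curve_add_int_mul, curve_add_int_mul, h])
  exact ⟨l - k, by push_cast; linarith⟩

end Tangle

/-- A Tangle fitting in a square packing, described on the lattice of the centers of the packing:
the `n`-th link belongs to the circle with index `ctr n`, and the unit vectors `fst n` and `snd n`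
point from there to its start and to its end. -/
structure LatticeTrace (T : Tangle) (P : SquarePacking T.radius) where
  ctr : ℤ → ℤ × ℤ
  fst : ℤ → ℤ × ℤ
  snd : ℤ → ℤ × ℤ
  isAxis_fst : ∀ n, IsAxis (fst n)
  snd_eq : ∀ n, snd n = rotate (fst n) ∨ snd n = -rotate (fst n)
  ctr_congr : ∀ n m, n ≡ m [ZMOD T.length] → ctr n = ctr m
  fst_congr : ∀ n m, n ≡ m [ZMOD T.length] → fst n = fst m
  snd_congr : ∀ n m, n ≡ m [ZMOD T.length] → snd n = snd m
  center_idx : ∀ n, T.center (T.idx n) = P.center (ctr n)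
  curve_eq : ∀ (n : ℤ) (t : ℝ), t ∈ Icc (n : ℝ) (n + 1) →
    T.curve t = P.center (ctr n) + T.radius * P.dir *
      (latticePoint (fst n) * Complex.cos ((t - n) * (Real.pi / 2)) +
        latticePoint (snd n) * Complex.sin ((t - n) * (Real.pi / 2)))
  deriv_eq : ∀ n : ℤ, deriv T.curve n = T.radius * P.dir * (Real.pi / 2) * latticePoint (snd n)
  snd_succ : ∀ n, snd (n + 1) = -fst n
  joint_succ : ∀ n, ctr (n + 1) + ctr (n + 1) + fst (n + 1) = ctr n + ctr n + snd n

lemma Tangle.FitsIn.nonempty_latticeTrace {T : Tangle} {P : SquarePacking T.radius}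
    (h : T.FitsIn P) : Nonempty (LatticeTrace T P) := by
  rw [Tangle.FitsIn] at h
  choose hz k hk using h
  choose z hz using hz
  choose e he hek using fun i => exists_isAxis_latticePoint_eq (k i)
  have hr := T.radius_ne_zero
  have hd := P.dir_ne_zero
  have hdir : ∀ n, T.startDir n = P.dir * latticePoint (e (T.idx n)) := by
    intro n
    have h1 := T.curve_intCast ((T.idx n : ℕ) : ℤ)
    have h2 := hk (T.idx n)
    rw [T.idx_coe] at h1
    push_cast at h1
    rw [h1, add_right_inj, mul_assoc] at h2
    have h3 := mul_left_cancel₀ hr h2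
    rw [hek, ← h3]
    simp only [Tangle.startDir, T.idx_coe]
  let a : ℤ → ℤ × ℤ := fun n => e (T.idx n)
  -- Turning the starting direction by a right angle in the sense of traversal gives both the end of
  -- the link and its initial tangent. Its final tangent is `-a n`, so `hsnd` expresses smoothness
  -- at the joint.
  let b : ℤ → ℤ × ℤ := fun n => ((T.turn (T.idx n) : ℤˣ) : ℤ) • rotate (a n)
  have hb : ∀ n, latticePoint (b n) = T.orient n * (Complex.I * latticePoint (a n)) := by
    intro n
    rw [← latticePoint_rotate]
    rcases Int.units_eq_one_or (T.turn (T.idx n)) with h | h <;>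
      simp [b, Tangle.orient, h, latticePoint_neg]
  have hsnd : ∀ n, b (n + 1) = -a n := by
    intro n
    apply latticePoint_injective
    rw [hb, latticePoint_neg]
    have h1 := T.orient_mul_startDir_succ n
    rw [hdir, hdir] at h1
    apply mul_left_cancel₀ hd
    linear_combination h1
  refine ⟨⟨fun n => z (T.idx n), a, b, fun n => he _, fun n => ?_,
    fun n m hnm => by simp only [T.idx_congr hnm], fun n m hnm => by simp only [a, T.idx_congr hnm],
    fun n m hnm => by simp only [b, a, T.idx_congr hnm], fun n => hz _, fun n t ht => ?_,
    fun n => ?_, hsnd, fun n => ?_⟩⟩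
  · rcases Int.units_eq_one_or (T.turn (T.idx n)) with h | h <;> simp [b, h]
  · rw [T.curve_eq_of_mem_Icc n ht, hdir, hz, hb]
    ring
  · rw [T.deriv_curve_of_mem_Icc n ⟨le_rfl, by linarith⟩, hdir, hb]
    simp
    ring
  · apply latticePoint_injective
    have h1 := T.curve_intCast_add_one n
    have h2 := T.curve_intCast (n + 1)
    push_cast at h2
    rw [h2, hdir, hdir, hz, hz, P.center_eq, P.center_eq] at h1
    simp only [latticePoint_add]
    rw [hb]
    apply mul_left_cancel₀ (mul_ne_zero hr hd)
    linear_combination h1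

end

/-! ### How links meet segments between centers, and how they meet at joints. -/

noncomputable section

open Set

/-- `e'` is perpendicular to `e` and of the same length. -/
def IsPerp (e e' : ℤ × ℤ) : Prop := e' = rotate e ∨ e' = -rotate e

lemma IsPerp.isAxis {e e' : ℤ × ℤ} (h : IsPerp e e') (he : IsAxis e) : IsAxis e' := by
  rcases h with rfl | rfl
  exacts [he.rotate, he.rotate.neg]

lemma IsPerp.symm {e e' : ℤ × ℤ} (h : IsPerp e e') : IsPerp e' e := by
  rcases h with rfl | rfl
  · right; ext <;> simp [rotate]
  · left; ext <;> simp [rotate]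

lemma IsPerp.neg_left {e e' : ℤ × ℤ} (h : IsPerp e e') : IsPerp (-e) e' := by
  rcases h with rfl | rfl
  · right; ext <;> simp [rotate]
  · left; ext <;> simp [rotate]

lemma IsPerp.neg_right {e e' : ℤ × ℤ} (h : IsPerp e e') : IsPerp e (-e') :=
  h.symm.neg_left.symm

lemma IsPerp.eq_or_eq_neg {e u v : ℤ × ℤ} (hu : IsPerp e u) (hv : IsPerp e v) :
    u = v ∨ u = -v := by
  rcases hu with rfl | rfl <;> rcases hv with rfl | rfl <;> simp

lemma IsAxis.ne_neg {e : ℤ × ℤ} (he : IsAxis e) : e ≠ -e := by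
  rcases he with rfl | rfl | rfl | rfl <;> simp

lemma IsAxis.ne_zero {e : ℤ × ℤ} (he : IsAxis e) : e ≠ 0 := by
  rcases he with rfl | rfl | rfl | rfl <;> simp

/-- In doubled coordinates a kissing point has exactly one odd coordinate, which fixes the axis; so
exactly two circles share the point. -/
lemma IsAxis.eq_of_add_self_add_eq {e u z w : ℤ × ℤ} (he : IsAxis e) (hu : IsAxis u)
    (h : w + w + u = z + z + e) : (w = z ∧ u = e) ∨ (w = z + e ∧ u = -e) := by
  obtain ⟨z1, z2⟩ := z
  obtain ⟨w1, w2⟩ := w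
  rcases he with rfl | rfl | rfl | rfl <;> rcases hu with rfl | rfl | rfl | rfl <;>
    simp at h ⊢ <;> omega

lemma IsPerp.eq_of_add_eq {e e' u v : ℤ × ℤ} (he : IsAxis e) (he' : IsPerp e e') (hu : IsAxis u)
    (huv : IsPerp u v) (h : u + v = e + e') : (u = e ∧ v = e') ∨ (u = e' ∧ v = e) := by
  rcases he with rfl | rfl | rfl | rfl <;> rcases hu with rfl | rfl | rfl | rfl <;>
    rcases he' with rfl | rfl <;> rcases huv with rfl | rfl <;> simp_all [rotate]

namespace SquarePacking

variable {r : ℝ} (P : SquarePacking r)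

/-- The similarity that carries the Gaussian integers to the centers of the packing. -/
def toPlane (w : ℂ) : ℂ := P.origin + 2 * (r : ℂ) * P.dir * w

lemma center_eq_toPlane (z : ℤ × ℤ) : P.center z = P.toPlane (latticePoint z) := rfl

lemma dist_toPlane (hr : 0 < r) (v w : ℂ) :
    dist (P.toPlane v) (P.toPlane w) = 2 * r * ‖v - w‖ := by
  rw [dist_eq_norm]
  have : P.toPlane v - P.toPlane w = 2 * (r : ℂ) * P.dir * (v - w) := by
    simp only [toPlane]; ring
  rw [this]
  simp [P.norm_dir, abs_of_pos hr]

lemma toPlane_injective (hr : 0 < r) : Function.Injective P.toPlane := fun v w h => by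
  have h1 := P.dist_toPlane hr v w
  rw [h, dist_self] at h1
  have h2 : ‖v - w‖ = 0 := by
    rcases mul_eq_zero.1 h1.symm with h | h
    · linarith
    · exact h
  exact sub_eq_zero.1 (norm_eq_zero.1 h2)

lemma exists_of_mem_segment {z w : ℤ × ℤ} {p : ℂ} (hp : p ∈ segment ℝ (P.center z) (P.center w)) :
    ∃ t : ℝ, 0 ≤ t ∧ t ≤ 1 ∧
      p = P.toPlane ⟨z.1 + t * ((w - z).1 : ℤ), z.2 + t * ((w - z).2 : ℤ)⟩ := by
  obtain ⟨a, b, ha, hb, hab, rfl⟩ := hp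
  refine ⟨b, hb, by linarith, ?_⟩
  have ha' : a = 1 - b := by linarith
  subst ha'
  rw [center_eq_toPlane, center_eq_toPlane]
  simp only [toPlane]
  rw [Complex.real_smul, Complex.real_smul]
  have : (⟨z.1 + b * ((w - z).1 : ℤ), z.2 + b * ((w - z).2 : ℤ)⟩ : ℂ) =
      latticePoint z + b * (latticePoint w - latticePoint z) := by
    apply Complex.ext <;> simp [latticePoint_re, latticePoint_im]
  rw [this]
  push_cast
  ring

lemma mem_segment_of_eq {z w : ℤ × ℤ} {t : ℝ} (h0 : 0 ≤ t) (h1 : t ≤ 1) :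
    P.toPlane ⟨z.1 + t * ((w - z).1 : ℤ), z.2 + t * ((w - z).2 : ℤ)⟩ ∈
      segment ℝ (P.center z) (P.center w) := by
  refine ⟨1 - t, t, by linarith, h0, by ring, ?_⟩
  rw [center_eq_toPlane, center_eq_toPlane]
  simp only [toPlane]
  rw [Complex.real_smul, Complex.real_smul]
  have : (⟨z.1 + t * ((w - z).1 : ℤ), z.2 + t * ((w - z).2 : ℤ)⟩ : ℂ) =
      latticePoint z + t * (latticePoint w - latticePoint z) := by
    apply Complex.ext <;> simp [latticePoint_re, latticePoint_im]
  rw [this]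
  push_cast
  ring

lemma dist_toPlane_center_le_iff (hr : 0 < r) (x y : ℝ) (q : ℤ × ℤ) :
    dist (P.toPlane ⟨x, y⟩) (P.center q) ≤ r ↔ (x - q.1) ^ 2 + (y - q.2) ^ 2 ≤ 1 / 4 := by
  rw [center_eq_toPlane, P.dist_toPlane hr, Complex.norm_eq_sqrt_sq_add_sq]
  simp only [Complex.sub_re, Complex.sub_im, latticePoint_re, latticePoint_im]
  rw [show (2 * r * √((x - q.1) ^ 2 + (y - q.2) ^ 2) ≤ r) ↔
      √((x - q.1) ^ 2 + (y - q.2) ^ 2) ≤ 1 / 2 by constructor <;> intro h <;> nlinarith,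
    Real.sqrt_le_left (by norm_num)]
  norm_num

end SquarePacking

/-- These are the two coordinates, in the frame of a link, of a point that the link shares with a
segment joining neighboring centers. Integrality of `m` forces `s = 0`, so the common point is an
end of the link, at the middle of the segment. -/
lemma two_mul_add_one_eq {σ m n : ℤ} (hσ : σ = 1 ∨ σ = -1) {c s t : ℝ} (hc : 0 ≤ c) (hs : 0 ≤ s)
    (hcs : c ^ 2 + s ^ 2 = 1) (ht0 : 0 ≤ t) (ht1 : t ≤ 1) (h0 : 0 = m + s / 2)
    (h1 : t * σ = n + c / 2) : m = 0 ∧ 2 * n + 1 = σ := by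
  have hs1 : s ≤ 1 := by nlinarith
  have hm : m = 0 := by
    have h2 : m < 1 := by exact_mod_cast (by linarith : (m : ℝ) < 1)
    have h3 : -1 < m := by exact_mod_cast (by linarith : (-1 : ℝ) < m)
    omega
  refine ⟨hm, ?_⟩
  subst hm
  have hs0 : s = 0 := by simpa using h0.symm
  subst hs0
  have hc1 : c = 1 := by nlinarith
  subst hc1
  rcases hσ with rfl | rfl <;> push_cast at h1
  · have h2 : n < 1 := by exact_mod_cast (by linarith : (n : ℝ) < 1)
    have h3 : -1 < n := by exact_mod_cast (by linarith : (-1 : ℝ) < n)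
    omega
  · have h2 : n < 0 := by exact_mod_cast (by linarith : (n : ℝ) < 0)
    have h3 : -2 < n := by exact_mod_cast (by linarith : (-2 : ℝ) < n)
    omega

lemma IsAxis.dot_self {a : ℤ × ℤ} (ha : IsAxis a) : a.1 * a.1 + a.2 * a.2 = 1 := by
  rcases ha with rfl | rfl | rfl | rfl <;> simp

lemma IsPerp.dot {a b : ℤ × ℤ} (hab : IsPerp a b) : a.1 * b.1 + a.2 * b.2 = 0 := by
  rcases hab with rfl | rfl <;> simp [rotate] <;> ring

lemma add_self_add_eq_of_eq_neg {e a b m : ℤ × ℤ} (ha : IsAxis a) (hab : IsPerp a b)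
    (hea : e = a ∨ e = -a) {c s t : ℝ} (hc : 0 ≤ c) (hs : 0 ≤ s) (hcs : c ^ 2 + s ^ 2 = 1)
    (ht0 : 0 ≤ t) (ht1 : t ≤ 1) (h1 : t * e.1 = m.1 + (a.1 * c + b.1 * s) / 2)
    (h2 : t * e.2 = m.2 + (a.2 * c + b.2 * s) / 2) : m + m + a = e := by
  obtain ⟨σ, hσ, rfl⟩ : ∃ σ : ℤ, (σ = 1 ∨ σ = -1) ∧ e = σ • a := by
    rcases hea with rfl | rfl
    exacts [⟨1, by simp⟩, ⟨-1, by simp⟩]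
  have haa : (a.1 * a.1 + a.2 * a.2 : ℝ) = 1 := by exact_mod_cast ha.dot_self
  have hbb : (b.1 * b.1 + b.2 * b.2 : ℝ) = 1 := by exact_mod_cast (hab.isAxis ha).dot_self
  have hab0 : (a.1 * b.1 + a.2 * b.2 : ℝ) = 0 := by exact_mod_cast hab.dot
  simp only [Prod.smul_fst, Prod.smul_snd, smul_eq_mul, Int.cast_mul] at h1 h2
  obtain ⟨h3, h4⟩ := two_mul_add_one_eq (m := m.1 * b.1 + m.2 * b.2) (n := m.1 * a.1 + m.2 * a.2) hσ
    hc hs hcs ht0 ht1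
    (by push_cast; linear_combination b.1 * h1 + b.2 * h2 + (c / 2 - t * σ) * hab0 + s / 2 * hbb)
    (by push_cast; linear_combination a.1 * h1 + a.2 * h2 + (c / 2 - t * σ) * haa + s / 2 * hab0)
  obtain ⟨m1, m2⟩ := m
  rcases ha with rfl | rfl | rfl | rfl <;> rcases hab with rfl | rfl <;>
    simp only [rotate, Prod.ext_iff, Prod.fst_add, Prod.snd_add, Prod.fst_neg, Prod.snd_neg,
      Prod.smul_fst, Prod.smul_snd, smul_eq_mul] at h3 h4 ⊢ <;> omega

lemma add_self_add_eq_of_axis_segment {e a b m : ℤ × ℤ} (he : IsAxis e) (ha : IsAxis a)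
    (hab : IsPerp a b) {c s t : ℝ} (hc : 0 ≤ c) (hs : 0 ≤ s) (hcs : c ^ 2 + s ^ 2 = 1)
    (ht0 : 0 ≤ t) (ht1 : t ≤ 1) (h1 : t * e.1 = m.1 + (a.1 * c + b.1 * s) / 2)
    (h2 : t * e.2 = m.2 + (a.2 * c + b.2 * s) / 2) : m + m + a = e ∨ m + m + b = e := by
  have h : (e = a ∨ e = -a) ∨ (e = b ∨ e = -b) := by
    rcases he with rfl | rfl | rfl | rfl <;> rcases ha with rfl | rfl | rfl | rfl <;>
      rcases hab with rfl | rfl <;> simp [rotate]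
  rcases h with h | h
  · exact .inl (add_self_add_eq_of_eq_neg ha hab h hc hs hcs ht0 ht1 h1 h2)
  · exact .inr (add_self_add_eq_of_eq_neg (hab.isAxis ha) hab.symm h hs hc (by linarith) ht0 ht1
      (by rw [h1]; ring) (by rw [h2]; ring))

/-- The point `(k, l)` has distance `|k - l| / √2` from the diagonal line, more than `1 / 2` unless
`k = l`. -/
lemma eq_or_eq_of_sq_add_sq_le {t : ℝ} (ht0 : 0 ≤ t) (ht1 : t ≤ 1) {k l : ℤ}
    (h : (t - k) ^ 2 + (t - l) ^ 2 ≤ 1 / 4) : k = l ∧ (k = 0 ∨ k = 1) := by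
  have hkl : k = l := by
    have h1 : ((k - l : ℤ) : ℝ) ^ 2 < 1 := by
      push_cast
      nlinarith [sq_nonneg ((t - k) + (t - l))]
    have h2 : (k - l) ^ 2 < 1 := by exact_mod_cast h1
    have h3 : k - l = 0 := by nlinarith
    omega
  subst hkl
  have h1 : |t - k| < 1 := by
    rw [← sq_lt_one_iff_abs_lt_one]
    nlinarith
  obtain ⟨h2, h3⟩ := abs_lt.1 h1
  have h4 : k < 2 := by exact_mod_cast (by linarith : (k : ℝ) < 2)
  have h5 : -1 < k := by exact_mod_cast (by linarith : (-1 : ℝ) < k)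
  omega

/-- Diagonal vectors of the square lattice. -/
def IsDiag (d : ℤ × ℤ) : Prop := (d.1 = 1 ∨ d.1 = -1) ∧ (d.2 = 1 ∨ d.2 = -1)

lemma IsAxis.add_isDiag {a b : ℤ × ℤ} (ha : IsAxis a) (hab : IsPerp a b) : IsDiag (a + b) := by
  rcases ha with rfl | rfl | rfl | rfl <;> rcases hab with rfl | rfl <;>
    simp [IsDiag, _root_.rotate]

lemma IsDiag.neg {d : ℤ × ℤ} (hd : IsDiag d) : IsDiag (-d) := by
  obtain ⟨h1, h2⟩ := hd
  simp only [IsDiag, Prod.fst_neg, Prod.snd_neg]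
  omega

lemma eq_or_eq_of_diag_segment {d m : ℤ × ℤ} (hd : IsDiag d) {t : ℝ} (ht0 : 0 ≤ t) (ht1 : t ≤ 1)
    (h : (t * d.1 - m.1) ^ 2 + (t * d.2 - m.2) ^ 2 ≤ 1 / 4) : m = 0 ∨ m = d := by
  obtain ⟨d1, d2⟩ := d
  obtain ⟨m1, m2⟩ := m
  obtain ⟨h1, h2⟩ := hd
  have key := eq_or_eq_of_sq_add_sq_le ht0 ht1 (k := d1 * m1) (l := d2 * m2) (by
    rcases h1 with rfl | rfl <;> rcases h2 with rfl | rfl <;> push_cast at h ⊢ <;> linarith)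
  rcases h1 with rfl | rfl <;> rcases h2 with rfl | rfl <;>
    simp only [Prod.ext_iff, Prod.fst_zero, Prod.snd_zero] at key ⊢ <;> omega

lemma add_eq_of_mul_diag_eq {d a b : ℤ × ℤ} (hd : IsDiag d) (ha : IsAxis a) (hab : IsPerp a b)
    {c s t : ℝ} (hc : 0 ≤ c) (hs : 0 ≤ s) (hcs : c ^ 2 + s ^ 2 = 1) (ht0 : 0 ≤ t)
    (h1 : t * d.1 = (a.1 * c + b.1 * s) / 2) (h2 : t * d.2 = (a.2 * c + b.2 * s) / 2) :
    a + b = d := by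
  have ht : 0 < t := by
    refine lt_of_le_of_ne ht0 fun h => ?_
    subst h
    rcases ha with rfl | rfl | rfl | rfl <;> rcases hab with rfl | rfl <;> simp [rotate] at h1 h2 <;>
      nlinarith
  obtain ⟨d1, d2⟩ := d
  obtain ⟨h3 | h3, h4 | h4⟩ := hd <;> simp only at h3 h4 <;> subst h3 h4 <;>
  rcases ha with rfl | rfl | rfl | rfl <;> rcases hab with rfl | rfl <;>
    simp [rotate] at h1 h2 ⊢ <;> linarith

namespace LatticeTrace

variable {T : Tangle} {P : SquarePacking T.radius} (τ : LatticeTrace T P)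

lemma isPerp (n : ℤ) : IsPerp (τ.fst n) (τ.snd n) := τ.snd_eq n

lemma isAxis_snd (n : ℤ) : IsAxis (τ.snd n) := (τ.isPerp n).isAxis (τ.isAxis_fst n)

lemma curve_eq_toPlane (n : ℤ) {t : ℝ} (ht : t ∈ Icc (n : ℝ) (n + 1)) :
    T.curve t = P.toPlane
      ⟨(τ.ctr n).1 + ((τ.fst n).1 * Real.cos ((t - n) * (Real.pi / 2)) +
          (τ.snd n).1 * Real.sin ((t - n) * (Real.pi / 2))) / 2,
        (τ.ctr n).2 + ((τ.fst n).2 * Real.cos ((t - n) * (Real.pi / 2)) +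
          (τ.snd n).2 * Real.sin ((t - n) * (Real.pi / 2))) / 2⟩ := by
  rw [τ.curve_eq n t ht]
  have h1 : ((t : ℂ) - n) * (Real.pi / 2) = (((t - n) * (Real.pi / 2) : ℝ) : ℂ) := by push_cast; rfl
  rw [h1, ← Complex.ofReal_cos, ← Complex.ofReal_sin]
  generalize Real.cos ((t - n) * (Real.pi / 2)) = c
  generalize Real.sin ((t - n) * (Real.pi / 2)) = s
  have h2 : (⟨(τ.ctr n).1 + ((τ.fst n).1 * c + (τ.snd n).1 * s) / 2,
      (τ.ctr n).2 + ((τ.fst n).2 * c + (τ.snd n).2 * s) / 2⟩ : ℂ) =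
      latticePoint (τ.ctr n) +
        (latticePoint (τ.fst n) * c + latticePoint (τ.snd n) * s) / 2 := by
    apply Complex.ext <;> simp [latticePoint]
  rw [h2, P.center_eq]
  simp only [SquarePacking.toPlane]
  ring

lemma exists_of_mem_carrier {p : ℂ} (hp : p ∈ T.carrier) :
    ∃ (n : ℤ) (c s : ℝ), 0 ≤ c ∧ 0 ≤ s ∧ c ^ 2 + s ^ 2 = 1 ∧ p = P.toPlane
      ⟨(τ.ctr n).1 + ((τ.fst n).1 * c + (τ.snd n).1 * s) / 2,
        (τ.ctr n).2 + ((τ.fst n).2 * c + (τ.snd n).2 * s) / 2⟩ := by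
  obtain ⟨t, rfl⟩ := hp
  have h1 := Int.floor_le t
  have h2 := Int.lt_floor_add_one t
  have hpi := Real.pi_pos
  refine ⟨⌊t⌋, Real.cos ((t - ⌊t⌋) * (Real.pi / 2)), Real.sin ((t - ⌊t⌋) * (Real.pi / 2)),
    Real.cos_nonneg_of_mem_Icc ⟨by nlinarith, by nlinarith⟩,
    Real.sin_nonneg_of_nonneg_of_le_pi (by nlinarith) (by nlinarith), Real.cos_sq_add_sin_sq _,
    τ.curve_eq_toPlane _ ⟨h1, h2.le⟩⟩

/-- The point at which the `n`-th link starts, in doubled coordinates. -/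
def joint (n : ℤ) : ℤ × ℤ := τ.ctr n + τ.ctr n + τ.fst n

lemma joint_add_one (n : ℤ) : τ.joint (n + 1) = τ.ctr n + τ.ctr n + τ.snd n := τ.joint_succ n

lemma curve_intCast (n : ℤ) :
    T.curve n = P.toPlane ⟨(τ.joint n).1 / 2, (τ.joint n).2 / 2⟩ := by
  rw [τ.curve_eq_toPlane n ⟨le_rfl, by linarith⟩]
  congr 2 <;> simp [joint] <;> ring

lemma modEq_of_eq {n m : ℤ} {x : ℝ} (h : T.curve (n + x) = T.curve (m + x)) :
    n ≡ m [ZMOD T.length] := by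
  obtain ⟨k, hk⟩ := T.exists_int_of_curve_eq h
  have h1 : n - m = k * T.length := by
    have : ((n - m : ℤ) : ℝ) = ((k * T.length : ℤ) : ℝ) := by push_cast; linarith
    exact_mod_cast this
  exact (Int.modEq_iff_dvd.2 ⟨k, by rw [h1, mul_comm]⟩).symm

lemma modEq_of_joint_eq {n m : ℤ} (h : τ.joint n = τ.joint m) : n ≡ m [ZMOD T.length] := by
  apply modEq_of_eq (T := T) (x := 0)
  rw [add_zero, add_zero, τ.curve_intCast, τ.curve_intCast, h]

lemma curve_intCast_add_half (n : ℤ) : T.curve (n + 1 / 2) = P.toPlane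
      ⟨(τ.ctr n).1 + √2 / 4 * ((τ.fst n + τ.snd n).1 : ℤ),
        (τ.ctr n).2 + √2 / 4 * ((τ.fst n + τ.snd n).2 : ℤ)⟩ := by
  rw [τ.curve_eq_toPlane n ⟨by linarith, by linarith⟩]
  have : ((n : ℝ) + 1 / 2 - n) * (Real.pi / 2) = Real.pi / 4 := by ring
  rw [this, Real.cos_pi_div_four, Real.sin_pi_div_four]
  congr 2 <;> simp <;> ring

/-- Center and diagonal direction determine the midpoint of a link, so a simple curve runs along
each quadrant at most once. -/
lemma modEq_of_corner_eq {n m : ℤ} (h : τ.ctr n = τ.ctr m)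
    (h' : τ.fst n + τ.snd n = τ.fst m + τ.snd m) : n ≡ m [ZMOD T.length] := by
  apply modEq_of_eq (T := T) (x := 1 / 2)
  rw [τ.curve_intCast_add_half, τ.curve_intCast_add_half, h, h']

/-- A link of the Tangle runs along the quadrant of the circle `z` in the diagonal direction `d`. -/
def Linked (z d : ℤ × ℤ) : Prop := ∃ n, τ.ctr n = z ∧ τ.fst n + τ.snd n = d

/-- The circles `z` and `z + e` kiss at a joint of the Tangle. -/
def HasJoint (z e : ℤ × ℤ) : Prop := ∃ n, τ.joint n = z + z + e

variable {τ} {z e e' d : ℤ × ℤ}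

/-- The two quadrants end at the same kissing point, on the same side of it. If both carried links,
these would be consecutive and form a cusp, or a joint would have two different links starting, or
two ending, there. -/
lemma Linked.not_linked_adjacent (he : IsAxis e) (hee : IsPerp e e') (h : τ.Linked z (e + e')) :
    ¬ τ.Linked (z + e) (-e + e') := by
  obtain ⟨n, hn, hn'⟩ := h
  rintro ⟨m, hm, hm'⟩
  have hj0 : ∀ n m, τ.joint n = τ.joint m → τ.ctr n = τ.ctr m ∧ τ.fst n = τ.fst m ∧
      τ.snd n = τ.snd m := fun n m h =>
    have := τ.modEq_of_joint_eq h
    ⟨τ.ctr_congr _ _ this, τ.fst_congr _ _ this, τ.snd_congr _ _ this⟩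
  have he0 := he.ne_zero
  have he'0 := (hee.isAxis he).ne_neg
  rcases hee.eq_of_add_eq he (τ.isAxis_fst n) (τ.isPerp n) hn' with ⟨h1, h2⟩ | ⟨h1, h2⟩ <;>
  rcases hee.neg_left.eq_of_add_eq he.neg (τ.isAxis_fst m) (τ.isPerp m) hm' with
    ⟨h3, h4⟩ | ⟨h3, h4⟩
  · have := (hj0 n m (by rw [joint, joint, hn, hm, h1, h3]; abel)).1
    rw [hn, hm] at this
    exact he0 (by simpa using this)
  · have := (hj0 n (m + 1) (by rw [joint_add_one, joint, hn, hm, h1, h4]; abel)).2.2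
    rw [τ.snd_succ, h2, h3] at this
    exact he'0 this
  · have := (hj0 (n + 1) m (by rw [joint_add_one, joint, hn, hm, h2, h3]; abel)).2.2
    rw [τ.snd_succ, h1, h4] at this
    exact he'0 this.symm
  · have h5 := τ.modEq_of_joint_eq (n := n + 1) (m := m + 1)
      (by rw [joint_add_one, joint_add_one, hn, hm, h2, h4]; abel)
    have := τ.ctr_congr _ _ (Int.ModEq.add_right_cancel' 1 h5)
    rw [hn, hm] at this
    exact he0 (by simpa using this)

/-- The curve crosses the line of centers perpendicularly at the joint, so one of the links before
and after it lies on the side `e'`; it belongs to one of the two kissing circles. -/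
lemma HasJoint.linked_or_linked (he : IsAxis e) (hee : IsPerp e e') (h : τ.HasJoint z e) :
    τ.Linked z (e + e') ∨ τ.Linked (z + e) (-e + e') := by
  obtain ⟨n, hn⟩ := h
  have hax : IsPerp e (τ.snd n) := by
    rcases he.eq_of_add_self_add_eq (τ.isAxis_fst n) hn with ⟨-, h2⟩ | ⟨-, h2⟩
    · rw [← h2]; exact τ.isPerp n
    · rw [← neg_neg e, ← h2]; exact (τ.isPerp n).neg_left
  rcases hax.eq_or_eq_neg hee with h | h
  · rcases he.eq_of_add_self_add_eq (τ.isAxis_fst n) hn with ⟨h1, h2⟩ | ⟨h1, h2⟩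
    · exact .inl ⟨n, h1, by rw [h2, h]⟩
    · exact .inr ⟨n, h1, by rw [h2, h]⟩
  · have h3 := τ.snd_succ (n - 1)
    have h4 := τ.joint_add_one (n - 1)
    rw [sub_add_cancel] at h3 h4
    rw [h, neg_inj] at h3
    rw [hn] at h4
    rcases he.eq_of_add_self_add_eq (τ.isAxis_snd (n - 1)) h4.symm with ⟨h1, h2⟩ | ⟨h1, h2⟩
    · exact .inl ⟨n - 1, h1, by rw [h2, ← h3, add_comm]⟩
    · exact .inr ⟨n - 1, h1, by rw [h2, ← h3, add_comm]⟩

lemma Linked.hasJoint (he : IsAxis e) (hee : IsPerp e e') (h : τ.Linked z (e + e')) :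
    τ.HasJoint z e := by
  obtain ⟨n, hn, hn'⟩ := h
  rcases hee.eq_of_add_eq he (τ.isAxis_fst n) (τ.isPerp n) hn' with ⟨h1, h2⟩ | ⟨h1, h2⟩
  · exact ⟨n, by rw [joint, hn, h1]⟩
  · exact ⟨n + 1, by rw [joint_add_one, hn, h2]⟩

variable (τ)

lemma disjoint_axis_segment (he : IsAxis e) (h : ¬ τ.HasJoint z e) :
    Disjoint (segment ℝ (P.center z) (P.center (z + e))) T.carrier := by
  rw [Set.disjoint_left]
  intro p hp hpc
  obtain ⟨t, ht0, ht1, rfl⟩ := P.exists_of_mem_segment hp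
  obtain ⟨n, c, s, hc, hs, hcs, heq⟩ := τ.exists_of_mem_carrier hpc
  have h1 := P.toPlane_injective T.radius_pos heq
  have hre := congrArg Complex.re h1
  have him := congrArg Complex.im h1
  simp only [add_sub_cancel_left] at hre him
  rcases add_self_add_eq_of_axis_segment (m := τ.ctr n - z) he (τ.isAxis_fst n) (τ.isPerp n) hc hs
    hcs ht0 ht1 (by simp only [Prod.fst_sub, Int.cast_sub]; linarith)
    (by simp only [Prod.snd_sub, Int.cast_sub]; linarith) with h2 | h2
  · exact h ⟨n, by rw [joint, ← h2]; abel⟩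
  · exact h ⟨n + 1, by rw [joint_add_one, ← h2]; abel⟩

lemma sq_add_sq_eq_quarter (n : ℤ) {c s : ℝ} (hcs : c ^ 2 + s ^ 2 = 1) :
    (((τ.fst n).1 * c + (τ.snd n).1 * s) / 2) ^ 2 +
      (((τ.fst n).2 * c + (τ.snd n).2 * s) / 2) ^ 2 = 1 / 4 := by
  have haa : ((τ.fst n).1 * (τ.fst n).1 + (τ.fst n).2 * (τ.fst n).2 : ℝ) = 1 := by
    exact_mod_cast (τ.isAxis_fst n).dot_self
  have hbb : ((τ.snd n).1 * (τ.snd n).1 + (τ.snd n).2 * (τ.snd n).2 : ℝ) = 1 := by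
    exact_mod_cast (τ.isAxis_snd n).dot_self
  have hab0 : ((τ.fst n).1 * (τ.snd n).1 + (τ.fst n).2 * (τ.snd n).2 : ℝ) = 0 := by
    exact_mod_cast (τ.isPerp n).dot
  linear_combination c ^ 2 / 4 * haa + s ^ 2 / 4 * hbb + c * s / 2 * hab0 + hcs / 4

lemma disjoint_diag_segment_iff (hd : IsDiag d) :
    Disjoint (segment ℝ (P.center z) (P.center (z + d))) T.carrier ↔
      ¬ τ.Linked z d ∧ ¬ τ.Linked (z + d) (-d) := by
  have h2 : √2 * √2 = 2 := Real.mul_self_sqrt (by norm_num)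
  have h0 := Real.sqrt_nonneg 2
  constructor
  · intro h
    rw [Set.disjoint_left] at h
    constructor
    · rintro ⟨n, hn, hn'⟩
      -- In lattice units the circle has radius `1 / 2` and the diagonal length `√2`, so the
      -- midpoint of the link divides the segment at `(1 / 2) / √2 = √2 / 4`.
      refine h (P.mem_segment_of_eq (t := √2 / 4) (by positivity) (by nlinarith)) ?_
      rw [add_sub_cancel_left, ← hn', ← hn, ← τ.curve_intCast_add_half]
      exact ⟨_, rfl⟩
    · rintro ⟨n, hn, hn'⟩
      refine h (P.mem_segment_of_eq (t := 1 - √2 / 4) (by nlinarith) (by linarith)) ?_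
      refine ⟨n + 1 / 2, ?_⟩
      rw [τ.curve_intCast_add_half, hn, hn']
      congr 2 <;> simp <;> ring
  · rintro ⟨h1, h1'⟩
    rw [Set.disjoint_left]
    intro p hp hpc
    obtain ⟨t, ht0, ht1, rfl⟩ := P.exists_of_mem_segment hp
    obtain ⟨n, c, s, hc, hs, hcs, heq⟩ := τ.exists_of_mem_carrier hpc
    have h3 := P.toPlane_injective T.radius_pos heq
    have hre := congrArg Complex.re h3
    have him := congrArg Complex.im h3
    simp only [add_sub_cancel_left] at hre him
    have h4 := τ.sq_add_sq_eq_quarter n hcs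
    rcases eq_or_eq_of_diag_segment (m := τ.ctr n - z) hd ht0 ht1 (by
      rw [← h4]
      apply le_of_eq
      congr 2 <;> simp only [Prod.fst_sub, Prod.snd_sub, Int.cast_sub] <;> linarith) with h5 | h5
    · have hz : τ.ctr n = z := sub_eq_zero.1 h5
      rw [hz] at hre him
      exact h1 ⟨n, hz, add_eq_of_mul_diag_eq hd (τ.isAxis_fst n) (τ.isPerp n) hc hs hcs ht0
        (by linarith) (by linarith)⟩
    · have hz : τ.ctr n = z + d := by rw [← h5]; abel
      rw [hz] at hre him
      simp only [Prod.fst_add, Prod.snd_add, Int.cast_add] at hre him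
      refine h1' ⟨n, hz, add_eq_of_mul_diag_eq (t := 1 - t) hd.neg (τ.isAxis_fst n) (τ.isPerp n)
        hc hs hcs (by linarith) ?_ ?_⟩
      · simp only [Prod.fst_neg, Int.cast_neg]; linarith
      · simp only [Prod.snd_neg, Int.cast_neg]; linarith

end LatticeTrace

end

/-! ### Inside and outside: the two sides of the Tangle. -/

noncomputable section

open Set

lemma SquarePacking.le_dist_toPlane_center_iff {r : ℝ} (P : SquarePacking r) (hr : 0 < r) (x y : ℝ)
    (q : ℤ × ℤ) :
    r ≤ dist (P.toPlane ⟨x, y⟩) (P.center q) ↔ 1 / 4 ≤ (x - q.1) ^ 2 + (y - q.2) ^ 2 := by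
  rw [center_eq_toPlane, P.dist_toPlane hr, Complex.norm_eq_sqrt_sq_add_sq]
  simp only [Complex.sub_re, Complex.sub_im, latticePoint_re, latticePoint_im]
  rw [show (r ≤ 2 * r * √((x - q.1) ^ 2 + (y - q.2) ^ 2)) ↔
      1 / 2 ≤ √((x - q.1) ^ 2 + (y - q.2) ^ 2) by constructor <;> intro h <;> nlinarith,
    Real.le_sqrt (by norm_num)]
  norm_num
  positivity

namespace Tangle

variable (T : Tangle)

lemma isCompact_carrier : IsCompact T.carrier := by
  have hL : (T.length : ℝ) ≠ 0 := by exact_mod_cast T.length_pos.ne'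
  exact T.closed.compact_of_continuous hL T.smooth.continuous

variable {T}

lemma mem_inside_iff_of_isPreconnected {s : Set ℂ} (hs : IsPreconnected s)
    (hd : Disjoint s T.carrier) {p q : ℂ} (hp : p ∈ s) (hq : q ∈ s) :
    p ∈ T.inside ↔ q ∈ T.inside := by
  have hsub : s ⊆ T.carrierᶜ := Set.subset_compl_iff_disjoint_right.2 hd
  have h := connectedComponentIn_eq (hs.subset_connectedComponentIn hp hsub hq)
  simp only [inside, mem_ofPred_eq, h]
  exact and_congr_left' ⟨fun _ => hsub hq, fun _ => hsub hp⟩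

variable (T)

lemma isBounded_inside : Bornology.IsBounded T.inside := by
  obtain ⟨R, hR⟩ := T.isCompact_carrier.isBounded.subset_closedBall 0
  refine (Metric.isBounded_closedBall (x := (0 : ℂ)) (r := R)).subset fun p hp => ?_
  by_contra hpR
  have hpR' : R < ‖p‖ := by simpa using hpR
  have hR0 : 0 ≤ R := by
    have := hR ⟨0, rfl⟩
    rw [mem_closedBall_zero_iff] at this
    exact (norm_nonneg _).trans this
  -- The ray from `p` away from the origin avoids the curve, so the component of `p` is unbounded.
  set s : Set ℂ := (fun x : ℝ => (x : ℂ) * p) '' Ici 1 with hs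
  have hpre : IsPreconnected s := isPreconnected_Ici.image _ (by fun_prop)
  have hsub : s ⊆ T.carrierᶜ := by
    rintro _ ⟨x, hx, rfl⟩ hc
    have h1 := hR hc
    rw [mem_closedBall_zero_iff, norm_mul, Complex.norm_real, Real.norm_eq_abs] at h1
    have h2 : 1 ≤ |x| := le_trans hx (le_abs_self x)
    nlinarith
  have hps : p ∈ s := ⟨1, by simp, by simp⟩
  have h1 := hp.2.subset (hpre.subset_connectedComponentIn hps hsub)
  obtain ⟨M, hM⟩ := h1.subset_closedBall 0
  have h2 := hM (show ((|M| / ‖p‖ + 1 : ℝ) : ℂ) * p ∈ s from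
    ⟨_, by simp only [mem_Ici]; linarith [show 0 ≤ |M| / ‖p‖ by positivity], rfl⟩)
  rw [mem_closedBall_zero_iff, norm_mul, Complex.norm_real, Real.norm_of_nonneg (by positivity)]
    at h2
  have h3 : (|M| / ‖p‖ + 1) * ‖p‖ = |M| + ‖p‖ := by
    field_simp [show ‖p‖ ≠ 0 by linarith]
  linarith [le_abs_self M]

variable {T} (P : SquarePacking T.radius)

lemma finite_setOf_center_mem_inside : {z | P.center z ∈ T.inside}.Finite := by
  obtain ⟨R, hR⟩ := T.isBounded_inside.subset_closedBall P.origin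
  have hr := T.radius_pos
  have key : ∀ z : ℤ × ℤ, P.center z ∈ T.inside → ‖latticePoint z‖ ≤ R / (2 * T.radius) := by
    intro z hz
    have h1 := hR hz
    have h2 : P.origin = P.toPlane 0 := by simp [SquarePacking.toPlane]
    rw [Metric.mem_closedBall, P.center_eq_toPlane, h2, P.dist_toPlane hr, sub_zero] at h1
    rw [le_div_iff₀ (by positivity)]
    linarith
  set M := ⌈R / (2 * T.radius)⌉ with hM
  refine ((Set.finite_Icc (-M) M).prod (Set.finite_Icc (-M) M)).subset fun z hz => ?_
  have h1 := key z hz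
  have h2 := (Complex.abs_re_le_norm _).trans (h1.trans (Int.le_ceil _))
  have h3 := (Complex.abs_im_le_norm _).trans (h1.trans (Int.le_ceil _))
  rw [latticePoint_re, abs_le] at h2
  rw [latticePoint_im, abs_le] at h3
  exact ⟨⟨by exact_mod_cast h2.1, by exact_mod_cast h2.2⟩,
    ⟨by exact_mod_cast h3.1, by exact_mod_cast h3.2⟩⟩

end Tangle

namespace LatticeTrace

variable {T : Tangle} {P : SquarePacking T.radius} (τ : LatticeTrace T P) {z e e' d : ℤ × ℤ}

-- The curve lies on circles of the packing, whose open discs are pairwise disjoint.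
include τ in
lemma radius_le_dist {p : ℂ} (hp : p ∈ T.carrier) (z : ℤ × ℤ) :
    T.radius ≤ dist p (P.center z) := by
  obtain ⟨n, c, s, hc, hs, hcs, rfl⟩ := τ.exists_of_mem_carrier hp
  rw [P.le_dist_toPlane_center_iff T.radius_pos]
  have h4 := τ.sq_add_sq_eq_quarter n hcs
  generalize ((τ.fst n).1 * c + (τ.snd n).1 * s) / 2 = u at *
  generalize ((τ.fst n).2 * c + (τ.snd n).2 * s) / 2 = v at *
  obtain ⟨m1, hm1⟩ : ∃ m : ℤ, m = (τ.ctr n).1 - z.1 := ⟨_, rfl⟩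
  obtain ⟨m2, hm2⟩ : ∃ m : ℤ, m = (τ.ctr n).2 - z.2 := ⟨_, rfl⟩
  have h1 : ((τ.ctr n).1 + u - z.1 : ℝ) = m1 + u := by rw [hm1]; push_cast; ring
  have h2 : ((τ.ctr n).2 + v - z.2 : ℝ) = m2 + v := by rw [hm2]; push_cast; ring
  rw [h1, h2]
  by_cases h0 : m1 = 0 ∧ m2 = 0
  · rw [h0.1, h0.2]
    push_cast
    linarith
  · have h5 : 1 ≤ m1 ^ 2 + m2 ^ 2 := by
      by_contra! h
      have : m1 ^ 2 + m2 ^ 2 = 0 := by nlinarith [sq_nonneg m1, sq_nonneg m2]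
      exact h0 ⟨by nlinarith [sq_nonneg m1, sq_nonneg m2], by nlinarith [sq_nonneg m1, sq_nonneg m2]⟩
    have h6 : (1 : ℝ) ≤ (m1 : ℝ) ^ 2 + (m2 : ℝ) ^ 2 := by exact_mod_cast h5
    -- Cauchy–Schwarz for the offset `(m1, m2)` of the centers and the vector `(u, v)` of length `1
    -- / 2`.
    have h7 : 4 * (m1 * u + m2 * v) ^ 2 ≤ (m1 : ℝ) ^ 2 + (m2 : ℝ) ^ 2 := by
      nlinarith [sq_nonneg (m1 * v - m2 * u)]
    have h8 : |2 * (m1 * u + m2 * v)| ≤ (m1 : ℝ) ^ 2 + (m2 : ℝ) ^ 2 :=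
      abs_le_of_sq_le_sq (by nlinarith) (by positivity)
    nlinarith [neg_abs_le (2 * (m1 * u + m2 * v))]

include τ in
lemma disjoint_ball_carrier (z : ℤ × ℤ) : Disjoint (Metric.ball (P.center z) T.radius) T.carrier := by
  rw [Set.disjoint_left]
  intro p hp hc
  exact absurd (τ.radius_le_dist hc z) (not_le.2 hp)

include τ in
lemma center_notMem_carrier (z : ℤ × ℤ) : P.center z ∉ T.carrier :=
  Set.disjoint_left.1 (τ.disjoint_ball_carrier z) (Metric.mem_ball_self T.radius_pos)

include τ in
lemma circleInside_iff : T.CircleInside P z ↔ P.center z ∈ T.inside := by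
  refine ⟨fun h => h (Metric.mem_ball_self T.radius_pos), fun h p hp => ?_⟩
  exact (Tangle.mem_inside_iff_of_isPreconnected (convex_ball _ _).isPreconnected
    (τ.disjoint_ball_carrier z) hp (Metric.mem_ball_self T.radius_pos)).2 h

lemma center_mem_inside_iff_of_not_hasJoint (he : IsAxis e) (h : ¬ τ.HasJoint z e) :
    P.center z ∈ T.inside ↔ P.center (z + e) ∈ T.inside :=
  Tangle.mem_inside_iff_of_isPreconnected (convex_segment _ _).isPreconnected
    (τ.disjoint_axis_segment he h) (left_mem_segment _ _ _) (right_mem_segment _ _ _)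

lemma center_mem_inside_iff_of_not_linked (hd : IsDiag d) (h : ¬ τ.Linked z d)
    (h' : ¬ τ.Linked (z + d) (-d)) :
    P.center z ∈ T.inside ↔ P.center (z + d) ∈ T.inside :=
  Tangle.mem_inside_iff_of_isPreconnected (convex_segment _ _).isPreconnected
    ((τ.disjoint_diag_segment_iff hd).2 ⟨h, h'⟩) (left_mem_segment _ _ _) (right_mem_segment _ _ _)

/-- The circle `z` is one of the two circles that kiss at the start of the `n`-th link. -/
def IsSide (n : ℤ) (z : ℤ × ℤ) : Prop := z = τ.ctr n ∨ z = τ.ctr n + τ.fst n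

lemma isSide_add_one_iff (n : ℤ) (z : ℤ × ℤ) :
    τ.IsSide (n + 1) z ↔ z = τ.ctr n ∨ z = τ.ctr n + τ.snd n := by
  have h := τ.joint_succ n
  rcases (τ.isAxis_snd n).eq_of_add_self_add_eq (τ.isAxis_fst (n + 1)) h with ⟨h1, h2⟩ | ⟨h1, h2⟩
  · rw [IsSide, h1, h2]
  · rw [IsSide, h1, h2, add_neg_cancel_right, or_comm]

end LatticeTrace

/-- A set of lattice points is infinite if it is nonempty and closed under a translation. -/
lemma Set.Finite.false_of_add_mem {s : Set (ℤ × ℤ)} (hs : s.Finite) {x v : ℤ × ℤ}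
    (hv : 0 < v.1) (hx : x ∈ s) (h : ∀ y ∈ s, y + v ∈ s) : False := by
  obtain ⟨y, hy, hmax⟩ := hs.exists_maximalFor Prod.fst s ⟨x, hx⟩
  have := hmax (h y hy)
  simp only [Prod.fst_add] at this
  omega

lemma IsAxis.even_add_iff {z e : ℤ × ℤ} (he : IsAxis e) :
    Even ((z + e).1 + (z + e).2) ↔ ¬ Even (z.1 + z.2) := by
  rcases he with rfl | rfl | rfl | rfl <;> simp only [Prod.fst_add, Prod.snd_add] <;>
    rw [Int.even_iff, Int.even_iff] <;> omega

lemma IsDiag.even_add_iff {z d : ℤ × ℤ} (hd : IsDiag d) :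
    Even ((z + d).1 + (z + d).2) ↔ Even (z.1 + z.2) := by
  obtain ⟨h1, h2⟩ := hd
  simp only [Prod.fst_add, Prod.snd_add]
  rw [Int.even_iff, Int.even_iff]
  omega

namespace LatticeTrace

variable {T : Tangle} {P : SquarePacking T.radius} (τ : LatticeTrace T P) {z e e' d : ℤ × ℤ}

lemma center_mem_inside_iff_of_isSide_add_one {n : ℤ} {x y : ℤ × ℤ} (hx : τ.IsSide n x)
    (hy : τ.IsSide (n + 1) y) (hxy : SameColor x y) :
    P.center x ∈ T.inside ↔ P.center y ∈ T.inside := by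
  rw [isSide_add_one_iff] at hy
  have ha := (τ.isAxis_fst n).even_add_iff (z := τ.ctr n)
  have hb := (τ.isAxis_snd n).even_add_iff (z := τ.ctr n)
  have hl : τ.Linked (τ.ctr n) (τ.fst n + τ.snd n) := ⟨n, rfl, rfl⟩
  rw [SameColor] at hxy
  rcases hx with rfl | rfl <;> rcases hy with rfl | rfl
  · rfl
  · tauto
  · tauto
  -- Here the link lies on the circle of the other color. The circles next to its two ends are
  -- joined by a diagonal segment, which no link crosses since it would form a cusp with the given
  -- one.
  · have h1 := hl.not_linked_adjacent (τ.isAxis_fst n) (τ.isPerp n)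
    rw [add_comm] at hl
    have h2 := hl.not_linked_adjacent (τ.isAxis_snd n) (τ.isPerp n).symm
    have h3 := τ.center_mem_inside_iff_of_not_linked
      ((τ.isAxis_fst n).neg.add_isDiag (τ.isPerp n).neg_left) h1 (by
        rwa [show τ.ctr n + τ.fst n + (-τ.fst n + τ.snd n) = τ.ctr n + τ.snd n by abel, show -(-τ.fst n + τ.snd n) = -τ.snd n + τ.fst n by abel])
    rw [h3]
    congr! 2
    abel

lemma exists_isSide (n : ℤ) (b : Prop) : ∃ x, τ.IsSide n x ∧ (Even (x.1 + x.2) ↔ b) := by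
  have ha := (τ.isAxis_fst n).even_add_iff (z := τ.ctr n)
  by_cases h : Even ((τ.ctr n).1 + (τ.ctr n).2) ↔ b
  · exact ⟨_, .inl rfl, h⟩
  · exact ⟨_, .inr rfl, by tauto⟩

lemma center_mem_inside_iff_of_isSide_zero (n : ℤ) {x y : ℤ × ℤ} (hx : τ.IsSide 0 x)
    (hy : τ.IsSide n y) (hxy : SameColor x y) :
    P.center x ∈ T.inside ↔ P.center y ∈ T.inside := by
  induction n generalizing y with
  | zero =>
    have ha := (τ.isAxis_fst 0).even_add_iff (z := τ.ctr 0)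
    rw [SameColor] at hxy
    rcases hx with rfl | rfl <;> rcases hy with rfl | rfl
    · rfl
    · tauto
    · tauto
    · rfl
  | succ n ih =>
    obtain ⟨w, hw, hw'⟩ := τ.exists_isSide n (Even (y.1 + y.2))
    exact (ih hw (hxy.trans hw'.symm)).trans (τ.center_mem_inside_iff_of_isSide_add_one hw hy hw')
  | pred n ih =>
    obtain ⟨w, hw, hw'⟩ := τ.exists_isSide (-n) (Even (y.1 + y.2))
    refine (ih hw (hxy.trans hw'.symm)).trans
      (τ.center_mem_inside_iff_of_isSide_add_one hy ?_ hw'.symm).symm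
    rwa [sub_add_cancel]

lemma isSide_of_joint_eq {n : ℤ} (he : IsAxis e) (h : τ.joint n = z + z + e) :
    τ.IsSide n z ∧ τ.IsSide n (z + e) := by
  rcases he.eq_of_add_self_add_eq (τ.isAxis_fst n) h with ⟨h1, h2⟩ | ⟨h1, h2⟩
  · simp [IsSide, h1, h2]
  · simp [IsSide, h1, h2]

/-- The two sides of a joint do not both lie outside the Tangle. -/
lemma center_mem_inside_or (n : ℤ) : P.center (τ.ctr n) ∈ T.inside ∨
    P.center (τ.ctr n + τ.fst n) ∈ T.inside := by
  set z := τ.ctr n with hz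
  set e := τ.fst n with he
  have hr := T.radius_ne_zero
  have hd := P.dir_ne_zero
  have hL : (0 : ℝ) < T.length := by exact_mod_cast T.length_pos
  have hex := τ.isAxis_fst n
  have hκ : latticePoint e ≠ 0 := by
    intro h
    refine hex.ne_zero (latticePoint_injective ?_)
    rw [← he, h]
    simp [latticePoint]
  have hcurve : T.curve n = P.center z + T.radius * P.dir * latticePoint e := by
    rw [τ.curve_eq n n ⟨le_rfl, by linarith⟩]
    simp [hz, he]
  have hq : P.center (z + e) = P.center z + 2 * (T.radius * P.dir * latticePoint e) := by
    rw [P.center_eq, P.center_eq, latticePoint_add]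
    ring
  -- The only point of the open segment with distance at least the radius from both centers is its
  -- midpoint, the joint; a simple curve passes there only once per period.
  have hmid : ∀ t : ℝ, ∀ y : ℝ, 0 < y →
      T.curve t - P.center z = -(y * (T.curve t - P.center (z + e))) → T.curve t = T.curve n := by
    intro t y hy h
    have hy' : (1 + y : ℂ) ≠ 0 := by
      exact_mod_cast (by positivity : 1 + y ≠ 0)
    have hy1 : (0 : ℝ) < 1 + y := by positivity
    have h1 : T.curve t - P.center z =
        ((2 * y / (1 + y) : ℝ) : ℂ) * (T.radius * P.dir * latticePoint e) := by
      push_cast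
      rw [div_mul_eq_mul_div, eq_div_iff hy']
      rw [hq] at h
      linear_combination h
    have h2 : T.curve t - P.center (z + e) =
        ((-(2 / (1 + y)) : ℝ) : ℂ) * (T.radius * P.dir * latticePoint e) := by
      rw [hq, ← sub_sub, h1]
      push_cast
      field_simp
      ring
    have hn : ‖(T.radius : ℂ) * P.dir * latticePoint e‖ = T.radius := by
      have h3 : ‖latticePoint e‖ = 1 := by
        have h4 : IsAxis e := hex
        rcases h4 with h4 | h4 | h4 | h4 <;> simp [h4, latticePoint]
      simp [P.norm_dir, h3, abs_of_pos T.radius_pos]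
    have h3 := τ.radius_le_dist ⟨t, rfl⟩ z
    have h4 := τ.radius_le_dist ⟨t, rfl⟩ (z + e)
    rw [dist_eq_norm, h1, norm_mul, hn, Complex.norm_real, Real.norm_of_nonneg (by positivity)] at h3
    rw [dist_eq_norm, h2, norm_mul, hn, Complex.norm_real, norm_neg,
      Real.norm_of_nonneg (by positivity)] at h4
    have h5 := (le_mul_iff_one_le_left T.radius_pos).1 h3
    have h6 := (le_mul_iff_one_le_left T.radius_pos).1 h4
    rw [le_div_iff₀ hy1] at h5 h6
    have h7 : y = 1 := by linarith
    subst h7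
    rw [hcurve, ← sub_eq_iff_eq_add', h1]
    norm_num
  have hne := windingIntegral_ne (ρ := 1) T.smooth T.closed hL (τ.center_notMem_carrier z)
    (τ.center_notMem_carrier (z + e)) n (by rw [hcurve, hq]; push_cast; ring)
    (fun t ht y hy h => by
      obtain ⟨k, hk⟩ := T.exists_int_of_curve_eq (hmid t y hy h)
      have h1 : (0 : ℝ) < k := by
        by_contra! h0
        nlinarith [ht.1]
      have h2 : (k : ℝ) < 1 := by
        by_contra! h0
        nlinarith [ht.2]
      have h1' : 0 < k := by exact_mod_cast h1
      have h2' : k < 1 := by exact_mod_cast h2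
      omega) one_pos (by
      have hsnd : latticePoint (τ.snd n) = Complex.I * latticePoint e ∨
          latticePoint (τ.snd n) = -Complex.I * latticePoint e := by
        rcases τ.snd_eq n with h | h <;> rw [h]
        · exact .inl (latticePoint_rotate _)
        · right
          rw [latticePoint_neg, latticePoint_rotate]
          ring
      -- The two perpendicular directions have quotient `±i`, so the imaginary part is `±π`: the
      -- crossing is transversal.
      have key : deriv T.curve n / (T.curve n - P.center z) -
          deriv T.curve n / (T.curve n - P.center (z + e)) =
          (Real.pi : ℂ) * (latticePoint (τ.snd n) / latticePoint e) := by
        rw [τ.deriv_eq, hq, hcurve]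
        have h1 : P.center z + T.radius * P.dir * latticePoint e - P.center z =
          T.radius * P.dir * latticePoint e := by ring
        have h2 : P.center z + T.radius * P.dir * latticePoint e - (P.center z +
          2 * (T.radius * P.dir * latticePoint e)) = -(T.radius * P.dir * latticePoint e) := by ring
        rw [h1, h2]
        field_simp
        ring
      rw [key]
      rcases hsnd with h | h <;> rw [h, mul_div_assoc, div_self hκ] <;>
        simp [Real.pi_ne_zero])
  by_contra! hcon
  have hzero : ∀ w, P.center w ∉ T.inside → windingIntegral T.curve T.length (P.center w) = 0 :=
    fun w hw => windingIntegral_eq_zero_of_not_isBounded T.smooth T.closed hL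
      (τ.center_notMem_carrier w) fun h => hw ⟨τ.center_notMem_carrier w, h⟩
  exact hne (by rw [hzero _ hcon.1, hzero _ hcon.2])

/-- One side of all joints lies inside the Tangle, the other outside. -/
lemma exists_forall_isSide : ∃ b : Prop, ∀ n x, τ.IsSide n x →
    (P.center x ∈ T.inside ↔ (Even (x.1 + x.2) ↔ b)) := by
  obtain ⟨x, hx, hx'⟩ := τ.exists_isSide 0 True
  obtain ⟨y, hy, hy'⟩ := τ.exists_isSide 0 False
  have hxor : P.center y ∈ T.inside ↔ P.center x ∉ T.inside := by
    have hor : P.center x ∈ T.inside ∨ P.center y ∈ T.inside := by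
      have ha := (τ.isAxis_fst 0).even_add_iff (z := τ.ctr 0)
      have := τ.center_mem_inside_or 0
      rcases hx with rfl | rfl <;> rcases hy with rfl | rfl <;> tauto
    refine ⟨fun h1 h2 => ?_, fun h => hor.resolve_left h⟩
    -- If both sides of the first joint were inside, so would be those of every joint. A step to the
    -- right from a circle inside would then always end inside.
    have hall : ∀ n w, τ.IsSide n w → P.center w ∈ T.inside := fun n w hw => by
      by_cases h : Even (w.1 + w.2)
      · exact (τ.center_mem_inside_iff_of_isSide_zero n hx hw (by rw [SameColor]; tauto)).1 h2
      · exact (τ.center_mem_inside_iff_of_isSide_zero n hy hw (by rw [SameColor]; tauto)).1 h1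
    refine (Tangle.finite_setOf_center_mem_inside P).false_of_add_mem (v := (1, 0)) one_pos h1
      fun w hw => ?_
    have hax : IsAxis (1, 0) := .inl rfl
    by_cases h : τ.HasJoint w (1, 0)
    · obtain ⟨n, hn⟩ := h
      exact hall n _ (τ.isSide_of_joint_eq hax hn).2
    · exact (τ.center_mem_inside_iff_of_not_hasJoint hax h).1 hw
  refine ⟨P.center x ∈ T.inside, fun n w hw => ?_⟩
  by_cases h : Even (w.1 + w.2)
  · have := τ.center_mem_inside_iff_of_isSide_zero n hx hw (by rw [SameColor]; tauto)
    tauto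
  · have := τ.center_mem_inside_iff_of_isSide_zero n hy hw (by rw [SameColor]; tauto)
    tauto

end LatticeTrace

end

/-! ### Quadrants, links and edges of the dual graph. -/

noncomputable section

open Set

lemma IsDiag.exists_eq_add {d : ℤ × ℤ} (hd : IsDiag d) :
    IsAxis (d.1, 0) ∧ IsPerp (d.1, 0) (0, d.2) ∧ d = (d.1, 0) + (0, d.2) := by
  obtain ⟨d1, d2⟩ := d
  obtain ⟨h1 | h1, h2 | h2⟩ := hd <;> simp only at h1 h2 <;> subst h1 h2 <;>
    simp [IsAxis, IsPerp, rotate]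

namespace LatticeTrace

variable {T : Tangle} {P : SquarePacking T.radius} (τ : LatticeTrace T P) {z w e e' d : ℤ × ℤ}
  {b : Prop}

/-- The sides of the joints that have the color `b` lie inside the Tangle, those that have the
other color lie outside. -/
def IsColor (b : Prop) : Prop :=
  ∀ n x, τ.IsSide n x → (P.center x ∈ T.inside ↔ (Even (x.1 + x.2) ↔ b))

/-- The circles `z` and `z + d` lie inside the Tangle, which does not separate them. -/
def IsEdge (z d : ℤ × ℤ) : Prop :=
  P.center z ∈ T.inside ∧ P.center (z + d) ∈ T.inside ∧ ¬ τ.Linked z d ∧ ¬ τ.Linked (z + d) (-d)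

variable {τ}

lemma IsEdge.symm (h : τ.IsEdge z d) : τ.IsEdge (z + d) (-d) := by
  obtain ⟨h1, h2, h3, h4⟩ := h
  refine ⟨h2, ?_, h4, ?_⟩ <;> rw [add_neg_cancel_right]
  · exact h1
  · rwa [neg_neg]

lemma IsColor.of_linked (hb : τ.IsColor b) (h : τ.Linked z d) :
    P.center z ∈ T.inside ↔ (Even (z.1 + z.2) ↔ b) := by
  obtain ⟨n, rfl, -⟩ := h
  exact hb n _ (.inl rfl)

lemma IsColor.of_hasJoint (hb : τ.IsColor b) (he : IsAxis e) (h : τ.HasJoint z e) :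
    (P.center z ∈ T.inside ↔ (Even (z.1 + z.2) ↔ b)) ∧
      (P.center (z + e) ∈ T.inside ↔ ¬ (Even (z.1 + z.2) ↔ b)) := by
  obtain ⟨n, hn⟩ := h
  obtain ⟨h1, h2⟩ := τ.isSide_of_joint_eq he hn
  have := he.even_add_iff (z := z)
  exact ⟨hb n _ h1, by rw [hb n _ h2]; tauto⟩

lemma hasJoint_of_inside (he : IsAxis e)
    (h1 : ¬ (P.center z ∈ T.inside ↔ P.center (z + e) ∈ T.inside)) : τ.HasJoint z e := by
  by_contra h
  exact h1 (τ.center_mem_inside_iff_of_not_hasJoint he h)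

/-- It must be excluded that only the opposite quadrant, that of `z + d`, carries a link. That link
would put the circle `z + e'` outside, where `d = e + e'`, hence produce a joint between `z` and `z
+ e'`; the link leaving it towards `e` is the excluded one at `z` or forms a cusp with the given
one. -/
lemma IsColor.linked_or_isEdge (hb : τ.IsColor b) (hz : P.center z ∈ T.inside)
    (hzb : Even (z.1 + z.2) ↔ b) (hd : IsDiag d) : τ.Linked z d ∨ τ.IsEdge z d := by
  by_cases h : τ.Linked z d
  · exact .inl h
  right
  have h' : ¬ τ.Linked (z + d) (-d) := by
    intro h'
    obtain ⟨he, hee, hde⟩ := hd.exists_eq_add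
    have hpar := hd.even_add_iff (z := z)
    generalize ((d.1, 0) : ℤ × ℤ) = e at *
    generalize ((0, d.2) : ℤ × ℤ) = e' at *
    subst hde
    rw [neg_add] at h'
    have h1 := hb.of_hasJoint he.neg (h'.hasJoint he.neg hee.neg_left.neg_right)
    rw [show z + (e + e') + -e = z + e' by abel] at h1
    have h2 : τ.HasJoint z e' := hasJoint_of_inside (hee.isAxis he) (by tauto)
    rcases h2.linked_or_linked (hee.isAxis he) hee.symm with h3 | h3
    · exact h (by rwa [add_comm] at h3)
    · rw [add_comm (-e')] at h3
      apply h3.not_linked_adjacent he hee.neg_right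
      rwa [show z + e' + e = z + (e + e') by abel]
  exact ⟨hz, (τ.center_mem_inside_iff_of_not_linked hd h h').1 hz, h, h'⟩

/-- A circle inside of the wrong color touches no joint, so its neighbors are inside and no link
comes between two consecutive ones. -/
lemma IsColor.isEdge_of_inside (hb : τ.IsColor b) (hw : P.center w ∈ T.inside)
    (hwb : ¬ (Even (w.1 + w.2) ↔ b)) (he : IsAxis e) (hee : IsPerp e e') :
    τ.IsEdge (w + e) (-e + e') := by
  have key : ∀ {e e'}, IsAxis e → IsPerp e e' → P.center (w + e) ∈ T.inside ∧
      ¬ τ.Linked (w + e) (-e + e') := fun {e e'} he hee => by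
    have h1 : ¬ τ.HasJoint w e := fun h => hwb ((hb.of_hasJoint he h).1.1 hw)
    refine ⟨(τ.center_mem_inside_iff_of_not_hasJoint he h1).1 hw, fun h => ?_⟩
    have h2 := (hb.of_hasJoint he.neg (h.hasJoint he.neg hee.neg_left)).2
    rw [add_neg_cancel_right] at h2
    have := he.even_add_iff (z := w)
    tauto
  have h1 : w + e + (-e + e') = w + e' := by abel
  have h2 : -(-e + e') = -e' + e := by abel
  refine ⟨(key he hee).1, ?_, (key he hee).2, ?_⟩ <;> rw [h1]
  · exact (key (hee.isAxis he) hee.symm).1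
  · rw [h2]
    exact (key (hee.isAxis he) hee.symm).2

/-- A link on the outer circle keeps the links of the neighbors away by the absence of cusps.
Conversely, an edge puts `w + e` inside, so `w` and `w + e` kiss at a joint, and the link on its
side `e'` can only belong to `w`. -/
lemma IsColor.linked_iff_isEdge (hb : τ.IsColor b) (hw : P.center w ∉ T.inside)
    (hwb : ¬ (Even (w.1 + w.2) ↔ b)) (he : IsAxis e) (hee : IsPerp e e') :
    τ.Linked w (e + e') ↔ τ.IsEdge (w + e) (-e + e') := by
  have h1 : w + e + (-e + e') = w + e' := by abel
  have h2 : -(-e + e') = -e' + e := by abel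
  constructor
  · intro h
    have h' := h
    rw [add_comm] at h'
    refine ⟨(hb.of_hasJoint he (h.hasJoint he hee)).2.2 hwb, ?_, h.not_linked_adjacent he hee, ?_⟩ <;>
      rw [h1]
    · exact (hb.of_hasJoint (hee.isAxis he) (h'.hasJoint (hee.isAxis he) hee.symm)).2.2 hwb
    · rw [h2]
      exact h'.not_linked_adjacent (hee.isAxis he) hee.symm
  · rintro ⟨h3, -, h4, -⟩
    exact ((hasJoint_of_inside he (by tauto)).linked_or_linked he hee).resolve_right h4

/-- Some link belongs to a circle inside the Tangle. -/
lemma IsColor.exists_ctr (hb : τ.IsColor b) : ∃ n, P.center (τ.ctr n) ∈ T.inside := by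
  by_contra! hcon
  obtain ⟨x, hx, hx'⟩ := τ.exists_isSide 0 b
  have hdiag : IsDiag (1, 1) := by simp [IsDiag]
  refine ((Tangle.finite_setOf_center_mem_inside P).inter_of_left
    {z | Even (z.1 + z.2) ↔ b}).false_of_add_mem (v := (1, 1)) (x := x) one_pos
    ⟨(hb 0 x hx).2 hx', hx'⟩ fun y hy => ?_
  rcases hb.linked_or_isEdge hy.1 hy.2 hdiag with ⟨n, hn, -⟩ | h
  · exact absurd (hn ▸ hy.1) (hcon n)
  · exact ⟨h.2.1, (hdiag.even_add_iff (z := y)).trans hy.2⟩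

lemma IsColor.mem_dualVertices_iff (hb : τ.IsColor b) :
    z ∈ T.dualVertices P ↔ P.center z ∈ T.inside ∧ (Even (z.1 + z.2) ↔ b) := by
  have hidx : ∀ i w, P.center w = T.center i → w = τ.ctr (i : ℕ) := fun i w h => by
    rw [← T.idx_coe i, τ.center_idx] at h
    exact latticePoint_injective (P.toPlane_injective T.radius_pos h)
  simp only [Tangle.dualVertices, Tangle.IsBlack, mem_ofPred_eq, τ.circleInside_iff]
  rw [and_comm]
  refine and_congr_right fun hz => ⟨?_, fun h => ?_⟩
  · rintro ⟨i, w, h1, h2, h3⟩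
    have := (hb _ w (.inl (hidx i w h1))).1 h2
    rw [SameColor] at h3
    tauto
  · obtain ⟨n, hn⟩ := hb.exists_ctr
    refine ⟨T.idx n, τ.ctr n, (τ.center_idx n).symm, hn, ?_⟩
    have := (hb n _ (.inl rfl)).1 hn
    rw [SameColor]
    tauto

end LatticeTrace

/-- If some coordinate of `w - z` is at least 2 in absolute value, the segment has a point where
that coordinate has moved by `±1`. Rounding the other coordinate there gives a third center within
distance `r`. Otherwise equal colors leave only the diagonal vectors. -/
lemma SquarePacking.isDiag_of_forall_disjoint {r : ℝ} (P : SquarePacking r) (hr : 0 < r)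
    {z w : ℤ × ℤ} (hzw : z ≠ w) (hc : SameColor z w)
    (h : ∀ q : ℤ × ℤ, q ≠ z → q ≠ w →
      Disjoint (segment ℝ (P.center z) (P.center w)) (Metric.closedBall (P.center q) r)) :
    IsDiag (w - z) := by
  obtain ⟨⟨a, b⟩, hd⟩ : ∃ v, v = w - z := ⟨_, rfl⟩
  have hw : w = z + (a, b) := by rw [hd]; abel
  subst hw
  have hab : (a + b) % 2 = 0 := by
    rw [SameColor, Int.even_iff, Int.even_iff] at hc
    simp only [Prod.fst_add, Prod.snd_add] at hc
    omega
  have h0 : ¬ (a = 0 ∧ b = 0) := by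
    rintro ⟨rfl, rfl⟩
    exact hzw (by ext <;> simp)
  by_contra hnd
  have key : ∀ (t : ℝ) (q1 q2 : ℤ), 0 ≤ t → t ≤ 1 → (q1, q2) ≠ (0, 0) → (q1, q2) ≠ (a, b) →
      (t * a - q1) ^ 2 + (t * b - q2) ^ 2 ≤ 1 / 4 → False := by
    intro t q1 q2 ht0 ht1 h1 h2 h3
    refine Set.disjoint_left.1 (h (z + (q1, q2)) (fun h => h1 (by simpa using h))
      (fun h => h2 (by simpa using h))) (P.mem_segment_of_eq ht0 ht1) ?_
    rw [Metric.mem_closedBall, P.dist_toPlane_center_le_iff hr]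
    refine le_of_eq_of_le ?_ h3
    simp only [add_sub_cancel_left, Prod.fst_add, Prod.snd_add]
    push_cast
    ring
  have hround : ∀ x : ℝ, (x - round x) ^ 2 ≤ 1 / 4 := fun x => by
    have := abs_sub_round x
    rw [← sq_abs]
    nlinarith [abs_nonneg (x - round x)]
  have hone : ∀ a : ℤ, 2 ≤ |a| → ∃ s : ℤ, (s = 1 ∨ s = -1) ∧ s ≠ a ∧ 1 / |(a : ℝ)| * a = s ∧
      0 ≤ 1 / |(a : ℝ)| ∧ 1 / |(a : ℝ)| ≤ 1 := fun a ha => by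
    have ha' : (2 : ℝ) ≤ |(a : ℝ)| := by exact_mod_cast ha
    have h2 : 1 / |(a : ℝ)| ≤ 1 := by rw [div_le_one (by linarith)]; linarith
    rcases abs_cases a with ⟨h3, h4⟩ | ⟨h3, h4⟩
    · refine ⟨1, .inl rfl, by omega, ?_, by positivity, h2⟩
      have h5 : (0 : ℝ) < a := by exact_mod_cast (by omega : 0 < a)
      rw [abs_of_pos h5]
      field_simp
      simp
    · refine ⟨-1, .inr rfl, by omega, ?_, by positivity, h2⟩
      have h5 : (a : ℝ) < 0 := by exact_mod_cast h4
      rw [abs_of_neg h5]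
      push_cast
      field_simp
      rw [div_self h5.ne]
  have hbig : 2 ≤ |a| ∨ 2 ≤ |b| := by
    by_contra! hlt
    have h1 := abs_lt.1 hlt.1
    have h2 := abs_lt.1 hlt.2
    rw [← hd] at hnd
    exact hnd ⟨show a = 1 ∨ a = -1 by omega, show b = 1 ∨ b = -1 by omega⟩
  rcases hbig with ha | ha
  · obtain ⟨s, hs, hsa, h1, h2, h3⟩ := hone a ha
    refine key (1 / |(a : ℝ)|) s (round (1 / |(a : ℝ)| * b)) h2 h3 ?_ ?_ ?_
    · simp only [ne_eq, Prod.mk.injEq, not_and]; omega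
    · simp only [ne_eq, Prod.mk.injEq, not_and]; omega
    · rw [h1, sub_self]
      linarith [hround (1 / |(a : ℝ)| * b)]
  · obtain ⟨s, hs, hsa, h1, h2, h3⟩ := hone b ha
    refine key (1 / |(b : ℝ)|) (round (1 / |(b : ℝ)| * a)) s h2 h3 ?_ ?_ ?_
    · simp only [ne_eq, Prod.mk.injEq, not_and]; omega
    · simp only [ne_eq, Prod.mk.injEq, not_and]; omega
    · rw [h1, sub_self]
      linarith [hround (1 / |(b : ℝ)| * a)]

lemma SquarePacking.disjoint_segment_closedBall_of_isDiag {r : ℝ} (P : SquarePacking r) (hr : 0 < r)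
    {z d q : ℤ × ℤ} (hd : IsDiag d) (hqz : q ≠ z) (hqw : q ≠ z + d) :
    Disjoint (segment ℝ (P.center z) (P.center (z + d))) (Metric.closedBall (P.center q) r) := by
  rw [Set.disjoint_left]
  intro p hp hpq
  obtain ⟨t, ht0, ht1, rfl⟩ := P.exists_of_mem_segment hp
  rw [Metric.mem_closedBall, P.dist_toPlane_center_le_iff hr] at hpq
  rcases eq_or_eq_of_diag_segment (m := q - z) hd ht0 ht1 (by
    refine le_of_eq_of_le ?_ hpq
    simp only [add_sub_cancel_left, Prod.fst_sub, Prod.snd_sub, Int.cast_sub]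
    ring) with h | h
  · exact hqz (sub_eq_zero.1 h)
  · exact hqw (by rw [← h]; abel)

lemma LatticeTrace.IsColor.adj_iff {T : Tangle} {P : SquarePacking T.radius}
    {τ : LatticeTrace T P} {b : Prop} (hb : τ.IsColor b) (x y : T.dualVertices P) :
    (T.dualGraph P).Adj x y ↔ IsDiag (y.1 - x.1) ∧ τ.IsEdge x (y.1 - x.1) := by
  obtain ⟨z, hz⟩ := x
  obtain ⟨w, hw⟩ := y
  obtain ⟨hz1, hz2⟩ := hb.mem_dualVertices_iff.1 hz
  obtain ⟨hw1, hw2⟩ := hb.mem_dualVertices_iff.1 hw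
  simp only [Tangle.dualGraph]
  have hwz : z + (w - z) = w := by abel
  constructor
  · rintro ⟨h1, h2, h3⟩
    have hd := P.isDiag_of_forall_disjoint T.radius_pos (fun h => h1 (Subtype.ext h))
      (hz2.trans hw2.symm) h3
    rw [← hwz, τ.disjoint_diag_segment_iff hd, hwz] at h2
    exact ⟨hd, hz1, by rwa [hwz], h2.1, by rw [hwz]; exact h2.2⟩
  · rintro ⟨hd, -, -, h3, h4⟩
    refine ⟨fun h => ?_, ?_, fun q hq hq' => ?_⟩
    · rw [Subtype.mk.injEq] at h
      simp [h, IsDiag] at hd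
    · have := (τ.disjoint_diag_segment_iff hd).2 ⟨h3, h4⟩
      rwa [hwz] at this
    · have := P.disjoint_segment_closedBall_of_isDiag T.radius_pos hd hq (by rwa [hwz])
      rwa [hwz] at this

end

/-! ### Counting vertices, edges and links. -/

noncomputable section

open Set

section Counting

open Finset

/-- Counting points of a finite planar set along lines: the set `E` of those points from which a
unit step `s` along a line `β = const` leads into `V`, and a set `F` of pairs of such steps lying
side by side. -/
lemma card_add_card_image_le {X : Type*} [DecidableEq X] {V E F : Finset X} (α β : X → ℤ)
    (s g₁ g₂ : X → X) (hV : V.Nonempty) (hαβ : ∀ x y, α x = α y → β x = β y → x = y) (hE : E ⊆ V)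
    (hs : ∀ x ∈ E, s x ∈ V) (hsα : ∀ x, α x < α (s x)) (hsβ : ∀ x, β (s x) = β x)
    (hg₁ : Function.Injective g₁) (h₁ : ∀ x ∈ F, g₁ x ∈ E) (h₂ : ∀ x ∈ F, g₂ x ∈ E)
    (hgα : ∀ x, α (g₂ x) = α (g₁ x)) (hgβ : ∀ x, β (g₂ x) < β (g₁ x)) :
    #E + #(V.image β) ≤ #V ∧ #F + #(E.image α) ≤ #E ∧ #E ≤ #(V.image β) * #(E.image α) ∧
      #(E.image α) + 1 ≤ #(V.image α) := by
  refine ⟨?_, ?_, ?_, ?_⟩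
  · have h : V.image β ⊆ (V \ E).image β := by
      intro y hy
      obtain ⟨x, hx, rfl⟩ := mem_image.1 hy
      -- The last point of `V` on each line starts no step.
      obtain ⟨z, hz, hmax⟩ := (V.filter fun z => β z = β x).exists_max_image α ⟨x, by simp [hx]⟩
      rw [mem_filter] at hz
      refine mem_image.2 ⟨z, mem_sdiff.2 ⟨hz.1, fun hzE => ?_⟩, hz.2⟩
      have := hmax (s z) (mem_filter.2 ⟨hs z hzE, by rw [hsβ, hz.2]⟩)
      exact absurd (hsα z) (not_lt.2 this)
    have h1 := (Finset.card_le_card h).trans card_image_le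
    have h2 := card_sdiff_add_card_eq_card hE
    omega
  · have hF : F.image g₁ ⊆ E := fun y hy => by
      obtain ⟨x, hx, rfl⟩ := mem_image.1 hy
      exact h₁ x hx
    have h : E.image α ⊆ (E \ F.image g₁).image α := by
      intro y hy
      obtain ⟨x, hx, rfl⟩ := mem_image.1 hy
      -- The step with least `β` on each level is not `g₁ w`, because `g₂ w` lies on the same level
      -- with smaller `β`.
      obtain ⟨z, hz, hmin⟩ := (E.filter fun z => α z = α x).exists_min_image β ⟨x, by simp [hx]⟩
      rw [mem_filter] at hz
      refine mem_image.2 ⟨z, mem_sdiff.2 ⟨hz.1, fun hzF => ?_⟩, hz.2⟩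
      obtain ⟨w, hw, rfl⟩ := mem_image.1 hzF
      have := hmin (g₂ w) (mem_filter.2 ⟨h₂ w hw, by rw [hgα, hz.2]⟩)
      exact absurd (hgβ w) (not_lt.2 this)
    have h1 := (Finset.card_le_card h).trans card_image_le
    have h2 := card_sdiff_add_card_eq_card hF
    rw [card_image_of_injective _ hg₁] at h2
    omega
  · rw [← card_product]
    refine card_le_card_of_injOn (fun x => (β x, α x)) (fun x hx => ?_) fun x _ y _ h => ?_
    · exact mem_product.2 ⟨mem_image_of_mem _ (hE hx), mem_image_of_mem _ hx⟩
    -- A step is determined by its line and its level.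
    · rw [Prod.mk.injEq] at h
      exact hαβ x y h.2 h.1
  · obtain ⟨z, hz, hmax⟩ := V.exists_max_image α hV
    have h : E.image α ⊆ (V.image α).erase (α z) := by
      intro y hy
      obtain ⟨x, hx, rfl⟩ := mem_image.1 hy
      refine mem_erase.2 ⟨fun h => ?_, mem_image_of_mem _ (hE hx)⟩
      have := hmax _ (hs x hx)
      have := hsα x
      omega
    have h1 := Finset.card_le_card h
    have h2 := card_erase_add_one (mem_image_of_mem α hz)
    omega

/-- Use `4pq' = (p + q')² - (p - q')²` and its analogue. The two subtracted squares cannot both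
vanish, as `p = q'` and `q = p'` would give `q' < q = p' < p = q'`. -/
lemma two_mul_add_one_le_sq_of_le {c e₁ e₂ p q p' q' : ℕ} (hpq : p + q' ≤ c) (hqp : q + p' ≤ c)
    (h₁ : e₁ ≤ p * q') (h₂ : e₂ ≤ q * p') (hq : q' + 1 ≤ q) (hp : p' + 1 ≤ p) :
    2 * (e₁ + e₂) + 1 ≤ c ^ 2 := by
  have key : 4 * e₁ + 4 * e₂ + 1 ≤ 2 * c ^ 2 := by
    have h3 : (1 : ℤ) ≤ (p - q') ^ 2 + (q - p') ^ 2 := by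
      by_cases h : p = q'
      · have h4 : (1 : ℤ) ≤ q - p' := by omega
        nlinarith [sq_nonneg ((p : ℤ) - q')]
      · have h4 : (0 : ℤ) < (p - q') ^ 2 := by
          have : (p : ℤ) - q' ≠ 0 := by omega
          positivity
        linarith [sq_nonneg ((q : ℤ) - p')]
    zify at hpq hqp h₁ h₂ ⊢
    have h5 : ((p : ℤ) + q') ^ 2 ≤ c ^ 2 := pow_le_pow_left₀ (by positivity) hpq 2
    have h6 : ((q : ℤ) + p') ^ 2 ≤ c ^ 2 := pow_le_pow_left₀ (by positivity) hqp 2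
    linarith
  -- Both sides being integers, `4m + 1 ≤ 2c²` improves to `2m + 1 ≤ c²`.
  omega

/-- Each circle of `F` is flanked by two parallel edges of either direction; `hc` cancels `F`
against the surplus of `V` over `c`. -/
lemma two_mul_add_one_le_sq {V E₁ E₂ F : Finset (ℤ × ℤ)} {c : ℕ} (hV : V.Nonempty)
    (h₁ : ∀ z ∈ E₁, z ∈ V ∧ z + (1, 1) ∈ V) (h₂ : ∀ z ∈ E₂, z ∈ V ∧ z + (1, -1) ∈ V)
    (hF₁ : ∀ w ∈ F, w + (0, -1) ∈ E₁ ∧ w + (-1, 0) ∈ E₁)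
    (hF₂ : ∀ w ∈ F, w + (-1, 0) ∈ E₂ ∧ w + (0, 1) ∈ E₂) (hc : #V = c + #F) :
    2 * (#E₁ + #E₂) + 1 ≤ c ^ 2 := by
  obtain ⟨a1, a2, a3, a4⟩ := card_add_card_image_le (V := V) (E := E₁) (F := F)
    (fun z => z.1 + z.2) (fun z => z.1 - z.2) (· + (1, 1)) (· + (0, -1)) (· + (-1, 0)) hV
    (fun x y h h' => by ext <;> omega) (fun z hz => (h₁ z hz).1) (fun z hz => (h₁ z hz).2)
    (fun z => by simp only [Prod.fst_add, Prod.snd_add]; omega)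
    (fun z => by simp only [Prod.fst_add, Prod.snd_add]; omega)
    (add_left_injective _) (fun w hw => (hF₁ w hw).1) (fun w hw => (hF₁ w hw).2)
    (fun z => by simp only [Prod.fst_add, Prod.snd_add]; omega)
    (fun z => by simp only [Prod.fst_add, Prod.snd_add]; omega)
  obtain ⟨b1, b2, b3, b4⟩ := card_add_card_image_le (V := V) (E := E₂) (F := F)
    (fun z => z.1 - z.2) (fun z => z.1 + z.2) (· + (1, -1)) (· + (0, 1)) (· + (-1, 0)) hV
    (fun x y h h' => by ext <;> omega) (fun z hz => (h₂ z hz).1) (fun z hz => (h₂ z hz).2)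
    (fun z => by simp only [Prod.fst_add, Prod.snd_add]; omega)
    (fun z => by simp only [Prod.fst_add, Prod.snd_add]; omega)
    (add_left_injective _) (fun w hw => (hF₂ w hw).2) (fun w hw => (hF₂ w hw).1)
    (fun z => by simp only [Prod.fst_add, Prod.snd_add]; omega)
    (fun z => by simp only [Prod.fst_add, Prod.snd_add]; omega)
  generalize #(V.image fun z => z.1 - z.2) = p at *
  generalize #(V.image fun z => z.1 + z.2) = q at *
  generalize #(E₁.image fun z => z.1 + z.2) = q' at *
  generalize #(E₂.image fun z => z.1 - z.2) = p' at *
  exact two_mul_add_one_le_sq_of_le (by omega) (by omega) a3 b3 a4 b4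

end Counting

namespace LatticeTrace

variable {T : Tangle} {P : SquarePacking T.radius} {τ : LatticeTrace T P} {z w e e' d : ℤ × ℤ}
  {b : Prop}

/-- The four diagonal vectors. -/
def diagonals : Finset (ℤ × ℤ) := {1, -1} ×ˢ {1, -1}

lemma mem_diagonals : d ∈ diagonals ↔ IsDiag d := by
  simp [diagonals, IsDiag]

lemma card_diagonals : diagonals.card = 4 := by decide

variable (τ)

/-- The quadrants of circles along which the links run. -/
def corners : Finset ((ℤ × ℤ) × (ℤ × ℤ)) :=
  (Finset.range T.length).image fun n : ℕ => (τ.ctr n, τ.fst n + τ.snd n)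

lemma card_corners : τ.corners.card = T.length := by
  rw [corners, Finset.card_image_of_injOn, Finset.card_range]
  intro n hn m hm h
  simp only [Finset.coe_range, mem_Iio] at hn hm
  simp only [Prod.mk.injEq] at h
  have h1 := τ.modEq_of_corner_eq h.1 h.2
  rw [Int.natCast_modEq_iff] at h1
  exact h1.eq_of_lt_of_lt hn hm

lemma mem_corners : (z, d) ∈ τ.corners ↔ τ.Linked z d := by
  simp only [corners, Finset.mem_image, Finset.mem_range, Prod.mk.injEq]
  constructor
  · rintro ⟨n, -, h⟩
    exact ⟨n, h⟩
  · rintro ⟨n, h1, h2⟩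
    have hL : (0 : ℤ) < T.length := by exact_mod_cast T.length_pos
    have h3 := Int.emod_lt_of_pos n hL
    have h4 := Int.emod_nonneg n hL.ne'
    have h5 : ((n % T.length).toNat : ℤ) ≡ n [ZMOD T.length] := by
      rw [Int.toNat_of_nonneg h4]
      exact Int.mod_modEq _ _
    exact ⟨(n % T.length).toNat, by omega, by rw [τ.ctr_congr _ _ h5, h1],
      by rw [τ.fst_congr _ _ h5, τ.snd_congr _ _ h5, h2]⟩

variable {τ}

lemma Linked.isDiag (h : τ.Linked z d) : IsDiag d := by
  obtain ⟨n, -, rfl⟩ := h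
  exact (τ.isAxis_fst n).add_isDiag (τ.isPerp n)

variable (P) in
/-- The circles of one color that lie inside the Tangle. -/
def insideCircles (b : Prop) : Finset (ℤ × ℤ) :=
  ((Tangle.finite_setOf_center_mem_inside P).inter_of_left {z | Even (z.1 + z.2) ↔ b}).toFinset

lemma mem_insideCircles :
    z ∈ insideCircles P b ↔ P.center z ∈ T.inside ∧ (Even (z.1 + z.2) ↔ b) := by
  simp [insideCircles]

open Classical in
variable (τ) in
/-- The circles inside the Tangle from which an edge leads into the direction `d`. -/
def edgesFrom (b : Prop) (d : ℤ × ℤ) : Finset (ℤ × ℤ) :=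
  (insideCircles P b).filter fun z => τ.IsEdge z d

lemma mem_edgesFrom : z ∈ τ.edgesFrom b d ↔ (Even (z.1 + z.2) ↔ b) ∧ τ.IsEdge z d := by
  simp only [edgesFrom, Finset.mem_filter, mem_insideCircles]
  constructor
  · rintro ⟨⟨-, h1⟩, h2⟩
    exact ⟨h1, h2⟩
  · rintro ⟨h1, h2⟩
    exact ⟨⟨h2.1, h1⟩, h2⟩

open Classical in
variable (τ) in
/-- The edges of the dual graph with an orientation, given by starting point and direction. -/
def orientedEdges (b : Prop) : Finset ((ℤ × ℤ) × (ℤ × ℤ)) :=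
  (insideCircles P b ×ˢ diagonals).filter fun x => τ.IsEdge x.1 x.2

lemma mem_orientedEdges : (z, d) ∈ τ.orientedEdges b ↔
    (Even (z.1 + z.2) ↔ b) ∧ IsDiag d ∧ τ.IsEdge z d := by
  simp only [orientedEdges, Finset.mem_filter, Finset.mem_product, mem_insideCircles,
    mem_diagonals]
  constructor
  · rintro ⟨⟨⟨-, h1⟩, h2⟩, h3⟩
    exact ⟨h1, h2, h3⟩
  · rintro ⟨h1, h2, h3⟩
    exact ⟨⟨⟨h3.1, h1⟩, h2⟩, h3⟩

lemma card_edgesFrom_neg (hd : IsDiag d) :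
    (τ.edgesFrom b (-d)).card = (τ.edgesFrom b d).card := by
  refine Finset.card_bij (fun z _ => z - d) (fun z hz => ?_) (fun z _ w _ h => sub_left_injective h)
    fun z hz => ⟨z + d, ?_, add_sub_cancel_right _ _⟩
  · rw [mem_edgesFrom] at hz ⊢
    have h := hz.2.symm
    rw [neg_neg, ← sub_eq_add_neg] at h
    refine ⟨?_, h⟩
    rw [← hz.1, sub_eq_add_neg]
    exact hd.neg.even_add_iff
  · rw [mem_edgesFrom] at hz ⊢
    exact ⟨hd.even_add_iff.trans hz.1, hz.2.symm⟩

lemma card_orientedEdges : (τ.orientedEdges b).card =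
    2 * ((τ.edgesFrom b (1, 1)).card + (τ.edgesFrom b (1, -1)).card) := by
  classical
  have h : ∀ d ∈ diagonals, ((τ.orientedEdges b).filter fun x => x.2 = d).card =
      (τ.edgesFrom b d).card := by
    intro d hd
    refine Finset.card_bij (fun x _ => x.1) ?_ ?_ ?_
    · rintro ⟨z, d'⟩ hx
      rw [Finset.mem_filter, mem_orientedEdges] at hx
      obtain ⟨⟨h1, -, h3⟩, rfl⟩ := hx
      exact mem_edgesFrom.2 ⟨h1, h3⟩
    · rintro ⟨z, d'⟩ hx ⟨w, d''⟩ hy h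
      rw [Finset.mem_filter] at hx hy
      exact Prod.ext h (hx.2.trans hy.2.symm)
    · intro z hz
      rw [mem_edgesFrom] at hz
      exact ⟨(z, d), Finset.mem_filter.2
        ⟨mem_orientedEdges.2 ⟨hz.1, mem_diagonals.1 hd, hz.2⟩, rfl⟩, rfl⟩
  have hmap : ∀ x ∈ τ.orientedEdges b, x.2 ∈ diagonals := by
    rintro ⟨z, d⟩ hx
    exact mem_diagonals.2 (mem_orientedEdges.1 hx).2.1
  rw [Finset.card_eq_sum_card_fiberwise hmap, Finset.sum_congr rfl h]
  have h1 := card_edgesFrom_neg (τ := τ) (b := b) (d := (1, 1)) (by simp [IsDiag])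
  have h2 := card_edgesFrom_neg (τ := τ) (b := b) (d := (1, -1)) (by simp [IsDiag])
  simp only [Prod.neg_mk, neg_neg] at h1 h2
  have h3 : diagonals = {(1, 1), (1, -1), (-1, 1), (-1, -1)} := by decide
  rw [h3, Finset.sum_insert (by decide), Finset.sum_insert (by decide),
    Finset.sum_insert (by decide), Finset.sum_singleton, h1, h2]
  ring

open Classical in
/-- At each quadrant of a circle inside the Tangle that has the color `b` there is either a link
or an edge. -/
lemma IsColor.four_mul_card (hb : τ.IsColor b) : 4 * (insideCircles P b).card =
    (τ.corners.filter fun x => (Even (x.1.1 + x.1.2) ↔ b)).card + (τ.orientedEdges b).card := by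
  rw [← card_diagonals, mul_comm, ← Finset.card_product, ← Finset.card_union_of_disjoint]
  · congr 1
    ext ⟨z, d⟩
    simp only [Finset.mem_product, Finset.mem_union, Finset.mem_filter, mem_insideCircles,
      mem_diagonals, mem_corners, mem_orientedEdges]
    constructor
    · rintro ⟨⟨h1, h2⟩, h3⟩
      rcases hb.linked_or_isEdge h1 h2 h3 with h | h
      · exact .inl ⟨h, h2⟩
      · exact .inr ⟨h2, h3, h⟩
    · rintro (⟨h1, h2⟩ | ⟨h1, h2, h3⟩)
      · exact ⟨⟨(hb.of_linked h1).2 h2, h2⟩, h1.isDiag⟩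
      · exact ⟨⟨h3.1, h1⟩, h2⟩
  · rw [Finset.disjoint_left]
    rintro ⟨z, d⟩ h1 h2
    rw [Finset.mem_filter, mem_corners] at h1
    rw [mem_orientedEdges] at h2
    exact h2.2.2.2.2.1 h1.1

/-- Matches a quadrant of a white circle with the oriented edge passing in front of it, started at
the horizontal neighbor so that the correspondence is one to one. -/
lemma IsColor.linked_or_inside_iff (hb : τ.IsColor b) (hd : IsDiag d) :
    (¬ (Even (w.1 + w.2) ↔ b) ∧ (τ.Linked w d ∨ P.center w ∈ T.inside)) ↔
    ((Even ((w + (d.1, 0)).1 + (w + (d.1, 0)).2) ↔ b) ∧ τ.IsEdge (w + (d.1, 0)) (-d.1, d.2)) := by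
  obtain ⟨he, hee, hde⟩ := hd.exists_eq_add
  have h1 : ((-d.1, d.2) : ℤ × ℤ) = -(d.1, 0) + (0, d.2) := by simp
  rw [h1]
  nth_rw 1 [hde]
  have h2 := he.even_add_iff (z := w)
  generalize ((d.1, 0) : ℤ × ℤ) = e at *
  generalize ((0, d.2) : ℤ × ℤ) = e' at *
  have h3 : (Even ((w + e).1 + (w + e).2) ↔ b) ↔ ¬ (Even (w.1 + w.2) ↔ b) := by tauto
  rw [h3]
  refine and_congr_right fun h4 => ?_
  by_cases hw : P.center w ∈ T.inside
  · simp only [hw, or_true, true_iff]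
    exact hb.isEdge_of_inside hw h4 he hee
  · simp only [hw, or_false]
    exact hb.linked_iff_isEdge hw h4 he hee

open Classical in
/-- The quadrants opposite to the edges are those at a link of a circle outside the Tangle, and
those of the circles inside. -/
lemma IsColor.card_orientedEdges_eq (hb : τ.IsColor b) : (τ.orientedEdges b).card =
    (τ.corners.filter fun x => ¬ (Even (x.1.1 + x.1.2) ↔ b)).card +
      4 * (insideCircles P ¬ b).card := by
  rw [← card_diagonals, mul_comm, ← Finset.card_product, ← Finset.card_union_of_disjoint]
  · symm
    refine Finset.card_bij (fun x _ => (x.1 + (x.2.1, 0), (-x.2.1, x.2.2))) ?_ ?_ ?_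
    · rintro ⟨w, d⟩ hx
      rw [mem_orientedEdges]
      simp only [Finset.mem_product, Finset.mem_union, Finset.mem_filter, mem_insideCircles,
        mem_diagonals, mem_corners] at hx
      have hd : IsDiag d := by
        rcases hx with h | h
        exacts [h.1.isDiag, h.2]
      have h := (hb.linked_or_inside_iff (w := w) hd).1 (by tauto)
      refine ⟨h.1, ?_, h.2⟩
      simp only [IsDiag] at hd ⊢
      omega
    · rintro ⟨⟨w1, w2⟩, d1, d2⟩ - ⟨⟨v1, v2⟩, c1, c2⟩ - h
      simp only [Prod.mk.injEq, Prod.mk_add_mk] at h ⊢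
      omega
    · rintro ⟨z, d⟩ hx
      rw [mem_orientedEdges] at hx
      obtain ⟨h1, hd, h3⟩ := hx
      have hd' : IsDiag (-d.1, d.2) := by
        simp only [IsDiag] at hd ⊢
        omega
      have e1 : z + (d.1, 0) + (-d.1, 0) = z := by ext <;> simp
      have h := (hb.linked_or_inside_iff (w := z + (d.1, 0)) hd').2 (by
        simp only [e1, neg_neg]
        exact ⟨h1, h3⟩)
      refine ⟨(z + (d.1, 0), (-d.1, d.2)), ?_, by simp only [e1, neg_neg]⟩
      simp only [Finset.mem_product, Finset.mem_union, Finset.mem_filter, mem_insideCircles,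
        mem_diagonals, mem_corners]
      tauto
  · rw [Finset.disjoint_left]
    rintro ⟨z, d⟩ h1 h2
    rw [Finset.mem_filter, mem_corners] at h1
    rw [Finset.mem_product, mem_insideCircles] at h2
    exact h1.2 ((hb.of_linked h1.1).1 h2.1.1)

lemma IsColor.card_insideCircles (hb : τ.IsColor b) {c : ℕ} (hc : T.length = 4 * c) :
    (insideCircles P b).card = c + (insideCircles P ¬ b).card := by
  classical
  have h1 := hb.four_mul_card
  have h2 := hb.card_orientedEdges_eq
  have h3 := τ.corners.card_filter_add_card_filter_not fun x => (Even (x.1.1 + x.1.2) ↔ b)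
  rw [τ.card_corners, hc] at h3
  omega

lemma IsColor.insideCircles_nonempty (hb : τ.IsColor b) : (insideCircles P b).Nonempty := by
  obtain ⟨n, hn⟩ := hb.exists_ctr
  exact ⟨_, mem_insideCircles.2 ⟨hn, (hb n _ (.inl rfl)).1 hn⟩⟩

lemma IsColor.card_orientedEdges_lt (hb : τ.IsColor b) {c : ℕ} (hc : T.length = 4 * c) :
    (τ.orientedEdges b).card + 1 ≤ c ^ 2 := by
  rw [card_orientedEdges]
  have hV : ∀ {z d}, IsDiag d → z ∈ τ.edgesFrom b d →
      z ∈ insideCircles P b ∧ z + d ∈ insideCircles P b := fun {z d} hd hz => by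
    rw [mem_edgesFrom] at hz
    exact ⟨mem_insideCircles.2 ⟨hz.2.1, hz.1⟩,
      mem_insideCircles.2 ⟨hz.2.2.1, hd.even_add_iff.trans hz.1⟩⟩
  have hF : ∀ {w}, w ∈ insideCircles P (¬ b) → ∀ e e', IsAxis e → IsPerp e e' →
      w + e ∈ τ.edgesFrom b (-e + e') := fun {w} hw e e' he hee => by
    rw [mem_insideCircles] at hw
    rw [mem_edgesFrom]
    have := he.even_add_iff (z := w)
    exact ⟨by tauto, hb.isEdge_of_inside hw.1 (by tauto) he hee⟩
  refine two_mul_add_one_le_sq hb.insideCircles_nonempty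
    (fun z hz => hV (by simp [IsDiag]) hz) (fun z hz => hV (by simp [IsDiag]) hz)
    (fun w hw => ⟨?_, ?_⟩) (fun w hw => ⟨?_, ?_⟩) (hb.card_insideCircles hc)
  · simpa using hF hw (0, -1) (1, 0) (by simp [IsAxis]) (by simp [IsPerp, rotate])
  · simpa using hF hw (-1, 0) (0, 1) (by simp [IsAxis]) (by simp [IsPerp, rotate])
  · simpa using hF hw (-1, 0) (0, -1) (by simp [IsAxis]) (by simp [IsPerp, rotate])
  · simpa using hF hw (0, 1) (1, 0) (by simp [IsAxis]) (by simp [IsPerp, rotate])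

end LatticeTrace

end

/-! ### Connectedness of the dual graph and the conclusion. -/

noncomputable section

open Set

namespace LatticeTrace

variable {T : Tangle} {P : SquarePacking T.radius} {τ : LatticeTrace T P} {b : Prop}

lemma IsColor.dualVertices_eq (hb : τ.IsColor b) : T.dualVertices P = insideCircles P b := by
  ext z
  rw [hb.mem_dualVertices_iff, Finset.mem_coe, mem_insideCircles]

lemma IsColor.mem_dualVertices_of_isSide (hb : τ.IsColor b) {n : ℤ} {x : ℤ × ℤ}
    (hx : τ.IsSide n x) (hxb : Even (x.1 + x.2) ↔ b) : x ∈ T.dualVertices P :=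
  hb.mem_dualVertices_iff.2 ⟨(hb n x hx).2 hxb, hxb⟩

/-- Along a link of a black circle the black side does not change; along a link of a white circle
its two black neighbors are joined by an edge. -/
lemma IsColor.reachable_of_isSide_add_one (hb : τ.IsColor b) {n : ℤ} {x y : T.dualVertices P}
    (hx : τ.IsSide n x) (hy : τ.IsSide (n + 1) y) : (T.dualGraph P).Reachable x y := by
  obtain ⟨x, hxV⟩ := x
  obtain ⟨y, hyV⟩ := y
  have hxb := (hb.mem_dualVertices_iff.1 hxV).2
  have hyb := (hb.mem_dualVertices_iff.1 hyV).2
  rw [isSide_add_one_iff] at hy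
  have ha := (τ.isAxis_fst n).even_add_iff (z := τ.ctr n)
  have hb' := (τ.isAxis_snd n).even_add_iff (z := τ.ctr n)
  simp only at hx hy
  rcases hx with rfl | rfl <;> rcases hy with rfl | rfl
  · rfl
  · tauto
  · tauto
  · have hw := hb n _ (.inl rfl)
    have hl : τ.Linked (τ.ctr n) (τ.fst n + τ.snd n) := ⟨n, rfl, rfl⟩
    have h1 := (hb.linked_iff_isEdge (by tauto) (by tauto) (τ.isAxis_fst n) (τ.isPerp n)).1 hl
    refine SimpleGraph.Adj.reachable ((hb.adj_iff _ _).2 ?_)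
    have h2 : τ.ctr n + τ.snd n - (τ.ctr n + τ.fst n) = -τ.fst n + τ.snd n := by abel
    rw [h2]
    exact ⟨(τ.isAxis_fst n).neg.add_isDiag (τ.isPerp n).neg_left, h1⟩

lemma IsColor.reachable_of_isSide (hb : τ.IsColor b) (n : ℤ) {x y : T.dualVertices P}
    (hx : τ.IsSide 0 x) (hy : τ.IsSide n y) : (T.dualGraph P).Reachable x y := by
  induction n generalizing y with
  | zero =>
    have hxb := (hb.mem_dualVertices_iff.1 x.2).2
    have hyb := (hb.mem_dualVertices_iff.1 y.2).2
    have ha := (τ.isAxis_fst 0).even_add_iff (z := τ.ctr 0)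
    have hxy : x = y := by
      apply Subtype.ext
      rcases hx with h | h <;> rcases hy with h' | h' <;> rw [h] at hxb ⊢ <;> rw [h'] at hyb ⊢ <;>
        tauto
    rw [hxy]
  | succ n ih =>
    obtain ⟨w, hw, hw'⟩ := τ.exists_isSide n b
    have hwV := hb.mem_dualVertices_of_isSide hw hw'
    exact (ih (y := ⟨w, hwV⟩) hw).trans (hb.reachable_of_isSide_add_one hw hy)
  | pred n ih =>
    obtain ⟨w, hw, hw'⟩ := τ.exists_isSide (-n) b
    have hwV := hb.mem_dualVertices_of_isSide hw hw'
    refine (ih (y := ⟨w, hwV⟩) hw).trans (hb.reachable_of_isSide_add_one hy ?_).symm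
    rwa [sub_add_cancel]

lemma IsColor.connected_dualGraph (hb : τ.IsColor b) : (T.dualGraph P).Connected := by
  obtain ⟨x, hx, hx'⟩ := τ.exists_isSide 0 b
  have hxV := hb.mem_dualVertices_of_isSide hx hx'
  rw [SimpleGraph.connected_iff_exists_forall_reachable]
  refine ⟨⟨x, hxV⟩, fun ⟨y, hy⟩ => ?_⟩
  by_contra hcon
  have hdiag : IsDiag (1, 1) := by simp [IsDiag]
  have hfin : {y | ∃ hy : y ∈ T.dualVertices P,
      ¬ (T.dualGraph P).Reachable ⟨x, hxV⟩ ⟨y, hy⟩}.Finite := by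
    refine (Finset.finite_toSet (insideCircles P b)).subset ?_
    rintro z ⟨hz, -⟩
    rwa [← hb.dualVertices_eq]
  -- All black circles at joints are reachable, so an unreachable one carries no link. It then has
  -- an edge in the direction `(1, 1)` to another unreachable one, and so on forever.
  refine hfin.false_of_add_mem (v := (1, 1)) one_pos ⟨hy, hcon⟩ ?_
  rintro z ⟨hz, hzr⟩
  obtain ⟨hz1, hz2⟩ := hb.mem_dualVertices_iff.1 hz
  rcases hb.linked_or_isEdge hz1 hz2 hdiag with ⟨n, hn, -⟩ | h
  · exact absurd (hb.reachable_of_isSide n hx (y := ⟨z, hz⟩) (.inl hn.symm)) hzr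
  · have hw : z + (1, 1) ∈ T.dualVertices P :=
      hb.mem_dualVertices_iff.2 ⟨h.2.1, hdiag.even_add_iff.trans hz2⟩
    refine ⟨hw, fun hr => hzr (hr.trans (SimpleGraph.Adj.reachable ((hb.adj_iff _ _).2 ?_)).symm)⟩
    rw [add_sub_cancel_left]
    exact ⟨hdiag, h⟩

lemma IsColor.finite_dualVertices (hb : τ.IsColor b) : Finite (T.dualVertices P) := by
  rw [hb.dualVertices_eq]
  exact (Finset.finite_toSet _).to_subtype

lemma IsColor.two_mul_size (hb : τ.IsColor b) : 2 * T.size P = (τ.orientedEdges b).card := by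
  classical
  have := hb.finite_dualVertices
  let _ : Fintype (T.dualVertices P) := Fintype.ofFinite _
  have h1 : T.size P = (T.dualGraph P).edgeFinset.card := by
    rw [Tangle.size, ← SimpleGraph.coe_edgeFinset, Set.ncard_coe_finset]
  rw [h1, ← SimpleGraph.dart_card_eq_twice_card_edges, ← Finset.card_univ]
  refine Finset.card_bij (fun a _ => (a.fst.1, a.snd.1 - a.fst.1)) (fun a _ => ?_)
    (fun a _ a' _ h => ?_) ?_
  · obtain ⟨hd, h⟩ := (hb.adj_iff _ _).1 a.adj
    exact mem_orientedEdges.2 ⟨(hb.mem_dualVertices_iff.1 a.fst.2).2, hd, h⟩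
  · rw [Prod.mk.injEq] at h
    have h2 := h.2
    rw [h.1, sub_left_inj] at h2
    exact SimpleGraph.Dart.ext _ _ (Prod.ext (Subtype.ext h.1) (Subtype.ext h2))
  · rintro ⟨z, d⟩ h
    obtain ⟨h1, h2, h3⟩ := mem_orientedEdges.1 h
    refine ⟨⟨(⟨z, hb.mem_dualVertices_iff.2 ⟨h3.1, h1⟩⟩,
      ⟨z + d, hb.mem_dualVertices_iff.2 ⟨h3.2.1, h2.even_add_iff.trans h1⟩⟩),
      (hb.adj_iff _ _).2 ?_⟩, Finset.mem_univ _, ?_⟩ <;> simp only [add_sub_cancel_left]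
    exact ⟨h2, h3⟩

lemma IsColor.card_le_size_add_one (hb : τ.IsColor b) :
    (insideCircles P b).card ≤ T.size P + 1 := by
  have := hb.finite_dualVertices
  have h := hb.connected_dualGraph.card_vert_le_card_edgeSet_add_one
  have hV : Nat.card (T.dualVertices P) = (insideCircles P b).card := by
    rw [hb.dualVertices_eq]
    exact Nat.card_eq_finsetCard _
  rw [← hV]
  exact h

end LatticeTrace

end

theorem mainTheorem1 (T : Tangle) (c : ℕ) (hc : T.HasClass c) :
    (∃ P : SquarePacking T.radius, T.FitsIn P) ∧
      ∀ P : SquarePacking T.radius, T.FitsIn P →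
        (T.dualGraph P).edgeSet.Finite ∧
          (c : ℝ) - 1 ≤ (T.size P : ℝ) ∧ (T.size P : ℝ) ≤ ((c : ℝ) ^ 2 - 1) / 2 := by
  refine ⟨T.exists_fitsIn, fun P hP => ?_⟩
  obtain ⟨τ⟩ := hP.nonempty_latticeTrace
  obtain ⟨b, hb⟩ : ∃ b, τ.IsColor b := τ.exists_forall_isSide
  have := hb.finite_dualVertices
  have h1 := hb.card_insideCircles hc
  have h2 := hb.card_le_size_add_one
  have h3 := hb.card_orientedEdges_lt hc
  rw [← hb.two_mul_size] at h3
  refine ⟨Set.toFinite _, ?_, ?_⟩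
  · have h4 : (c : ℝ) ≤ T.size P + 1 := by exact_mod_cast (by omega : c ≤ T.size P + 1)
    linarith
  · have h4 : (2 * T.size P + 1 : ℝ) ≤ (c : ℝ) ^ 2 := by exact_mod_cast h3
    linarith
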